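/- A looped simple graph $G=(V,E,L)$ consists of a finite simple graph $(V,E)$ and a finite set $L$ of loops, each placed at a vertex of $V$ (several loops at one vertex are allowed). Given $p:V\to\mathbb{R}^d$ and $q:L\to\mathbb{R}^d$, the rigidity matrix $R(G,p,q)$ is the $(|E|+|L|)\times d|V|$ matrix in which the row of an edge $uv\in E$ has $p(u)-p(v)$ in the $d$ columns of $u$, $p(v)-p(u)$ in the $d$ columns of $v$, and zeros elsewhere, and the row of a loop $\ell\in L$ at $v$ has $q(\ell)$ in the $d$ columns of $v$ and zeros elsewhere. $G$ is rigid in $\mathbb{R}^d$ if $\operatorname{rank}R(G,p,q)=d|V|$ for some $p,q$. For $X\subseteq V$ let $i(X)$ be the number of edges and loops of $G$ all of whose end-vertices lie in $X$; $G$ is $d$-tight if $i(X)\le d|X|$ for all $X\subseteq V$ and $|E|+|L|=d|V|$. $G$ is $K_{k}$-free if it has no subgraph isomorphic to the complete graph $K_{k}$. Theorem. Let $d\ge 2$ be an integer and let $G$ be a looped simple graph in which every vertex is incident with at least $\lfloor d/2\rfloor$ loops. Then $G$ is rigid in $\mathbb{R}^d$ if and only if $G$ has a spanning subgraph $H$ (all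 vertices of $G$, some of its edges and some of its loops) that is $d$-tight, $K_{d+2}$-free, and has at least $\lfloor d/2\rfloor$ loops at every vertex. -/

import Mathlib

universe u v

/-- A looped simple graph `G = (V, E, L)`: a simple graph on `V` (whose edges are the elements of
`E`) together with a family of loops indexed by `L`, the loop `ℓ` being placed at the vertex
`base ℓ`.  Several loops at the same vertex are allowed. -/
structure LoopedSimpleGraph (V : Type u) (L : Type v) where
  /-- the underlying simple graph, carrying the edges -/
  graph : SimpleGraph V
  /-- the vertex at which a loop is placed -/
  base : L → V

namespace LoopedSimpleGraph

/-- The entry, in the column of coordinate `k` of the vertex `w`, of the row of the bar-joint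
rigidity matrix indexed by the edge `uv`: it is `p(u) - p(v)` in the columns of `u`, `p(v) - p(u)`
in the columns of `v`, and zero elsewhere. -/
def edgeEntry {V : Type u} [DecidableEq V] {d : ℕ} (p : V → Fin d → ℝ) (w : V) (k : Fin d)
    (e : Sym2 V) : ℝ :=
  Sym2.lift
    ⟨fun u v => if w = u then p u k - p v k else if w = v then p v k - p u k else 0, by
      intro u v
      by_cases hu : w = u <;> by_cases hv : w = v <;> simp_all⟩ e

/-- The rigidity matrix `R(G, p, q)` of the linearly constrained framework `(G, p, q)` in `ℝ^d`.
Its rows are indexed by the edges and the loops of `G`, its columns by `V × {1, …, d}`. -/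
def rigidityMatrix {V : Type u} {L : Type v} [DecidableEq V] (G : LoopedSimpleGraph V L) {d : ℕ}
    (p : V → Fin d → ℝ) (q : L → Fin d → ℝ) : Matrix (G.graph.edgeSet ⊕ L) (V × Fin d) ℝ :=
  Matrix.of fun r c =>
    match r with
    | Sum.inl e => edgeEntry p c.1 c.2 (e : Sym2 V)
    | Sum.inr l => if c.1 = G.base l then q l c.2 else 0

/-- `G` is rigid in `ℝ^d` if `rank R(G, p, q) = d |V|` for some realisation `(G, p, q)`
in `ℝ^d`. -/
def IsRigid {V : Type u} {L : Type v} [Fintype V] [DecidableEq V] (G : LoopedSimpleGraph V L)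
    (d : ℕ) : Prop :=
  ∃ (p : V → Fin d → ℝ) (q : L → Fin d → ℝ),
    (G.rigidityMatrix p q).rank = d * Fintype.card V

/-- `i(X)`: the number of edges and loops in the subgraph of `G` induced by `X`. -/
noncomputable def inducedCount {V : Type u} {L : Type v} (G : LoopedSimpleGraph V L)
    (X : Finset V) : ℕ :=
  {e : Sym2 V | e ∈ G.graph.edgeSet ∧ ∀ x ∈ e, x ∈ X}.ncard + {l : L | G.base l ∈ X}.ncard

/-- `G` is `k`-sparse if `i(X) ≤ k |X|` for all `X ⊆ V`. -/
def IsSparse {V : Type u} {L : Type v} (G : LoopedSimpleGraph V L) (k : ℕ) : Prop :=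
  ∀ X : Finset V, G.inducedCount X ≤ k * X.card

/-- `G` is `k`-tight if it is `k`-sparse and `|E ∪ L| = k |V|`. -/
def IsTight {V : Type u} {L : Type v} (G : LoopedSimpleGraph V L) (k : ℕ) : Prop :=
  G.IsSparse k ∧ G.graph.edgeSet.ncard + Nat.card L = k * Nat.card V

/-- The number of loops at the vertex `x`. -/
noncomputable def loopCount {V : Type u} {L : Type v} (G : LoopedSimpleGraph V L) (x : V) : ℕ :=
  {l : L | G.base l = x}.ncard

/-- A spanning subgraph of `G`: it has all the vertices of `G`, some of the edges and some of
the loops. -/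
structure SpanningSubgraph {V : Type u} {L : Type v} (G : LoopedSimpleGraph V L) where
  /-- the edges that are kept -/
  graph : SimpleGraph V
  graph_le : graph ≤ G.graph
  /-- the loops that are kept -/
  loops : Set L

/-- A spanning subgraph, as a looped simple graph on the same vertex set. -/
def SpanningSubgraph.toLooped {V : Type u} {L : Type v} {G : LoopedSimpleGraph V L}
    (H : G.SpanningSubgraph) : LoopedSimpleGraph V H.loops where
  graph := H.graph
  base := fun l => G.base l

end LoopedSimpleGraph

/-!
Write `t = d - d / 2`, so that `2 t ≤ d + 1`.

If `G` is rigid, then for generic `q` the rows of any chosen `d / 2` loops at each vertex are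
independent, so they extend to a basis of the row space; the edges and loops in this basis form `H`.
It is `d`-tight since the rows supported on `X` number at most `d |X|`, and it contains no `K_{d+2}`
since `d + 2` points of `ℝ^d` have an affine dependence, which gives a stress on the complete graph.

Conversely, let `H` be as in the theorem, and set aside `d / 2` loops at each vertex; what remains is
`t`-tight. The loops set aside confine the velocity of `u` to a `t`-dimensional space `W u`, which can
be prescribed. So positions `p` and vectors `a u 1, …, a u t` are needed for which the `t |V|` motions
"`u` moves with velocity `a u i`, all other vertices rest" change the lengths of the remaining edges
in linearly independent ways. By Rado's theorem for subspaces
(`exists_linearIndependent_of_card_le_finrank_sup`) such vectors exist if for every `Y ⊆ V` the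
motions of the vertices in `Y` have an image of dimension at least `t |Y|`. This holds as soon as
`t |Y|` edges are independent in the framework in which the vertices outside `Y` are pinned.

To find these edges, assign each edge to one of its ends, `t` edges to each vertex, which is possible
by Hall's theorem (`exists_orientation`), and take the edges assigned to `Y`. They are sparse enough
for the average degree in `Y` to be at most `2 t ≤ d + 1`, and this passes to subgraphs. So vertices
of degree at most `d` can be removed one after the other, which preserves independence
(`eventually_rowsIndependent_of_ncard_neighborSet_le`), until no edge is left or the
remaining edges form a `(d + 1)`-regular graph without pinned vertices. In the latter, as it contains
no `K_{d+2}`, some vertex has two nonadjacent neighbours, and a 1-extension reduces it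
(`exists_rowsIndependent_of_one_extension`); a suitable choice of the vertex creates no `K_{d+2}` (`exists_cliqueFree_pinch`).

Remaining loops are treated as edges to new pinned vertices (`pinnedGraph`). As all independence
statements hold for generic positions once they hold for one, they can be combined freely; this is
expressed with the filter `genericFilter`.
-/

/-! ### Generic points -/

/-- The filter of generic subsets of `ℝ^σ`: those containing the complement of the zero set of some
nonzero polynomial. -/
def genericFilter (σ : Type*) : Filter (σ → ℝ) where
  sets := {s | ∃ g : MvPolynomial σ ℝ, g ≠ 0 ∧ ∀ x, MvPolynomial.eval x g ≠ 0 → x ∈ s}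
  univ_sets := ⟨1, one_ne_zero, fun _ _ => Set.mem_univ _⟩
  sets_of_superset := by
    rintro s t ⟨g, hg, h⟩ hst
    exact ⟨g, hg, fun x hx => hst (h x hx)⟩
  inter_sets := by
    rintro s t ⟨g, hg, h⟩ ⟨g', hg', h'⟩
    refine ⟨g * g', mul_ne_zero hg hg', fun x hx => ?_⟩
    rw [map_mul] at hx
    exact ⟨h x (left_ne_zero_of_mul hx), h' x (right_ne_zero_of_mul hx)⟩

instance genericFilter_neBot (σ : Type*) : (genericFilter σ).NeBot := by
  rw [Filter.neBot_iff, Ne, ← Filter.empty_mem_iff_bot]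
  rintro ⟨g, hg, h⟩
  refine hg (MvPolynomial.funext fun x => ?_)
  by_contra hx
  exact h x (by simpa using hx)

theorem eventually_genericFilter {σ : Type*} {P : (σ → ℝ) → Prop} (g : MvPolynomial σ ℝ)
    (hg : g ≠ 0) (h : ∀ x, MvPolynomial.eval x g ≠ 0 → P x) : ∀ᶠ x in genericFilter σ, P x :=
  ⟨g, hg, h⟩

/-- Vectors whose coordinates are polynomials in `x` are linearly independent for generic `x` as
soon as they are so for one `x`: over `ℝ`, independence is the nonvanishing of the Gram
determinant, which is a polynomial in `x`. -/
theorem eventually_linearIndependent {σ ι κ : Type*} [Finite ι] [Finite κ]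
    (f : (σ → ℝ) → ι → κ → ℝ)
    (hf : ∀ i k, ∃ g : MvPolynomial σ ℝ, ∀ x, MvPolynomial.eval x g = f x i k)
    {x₀ : σ → ℝ} (h : LinearIndependent ℝ (f x₀)) :
    ∀ᶠ x in genericFilter σ, LinearIndependent ℝ (f x) := by
  classical
  have := Fintype.ofFinite ι
  have := Fintype.ofFinite κ
  choose g hg using hf
  let N : Matrix ι κ (MvPolynomial σ ℝ) := Matrix.of g
  have hN : ∀ x, N.map (MvPolynomial.eval x) = Matrix.of (f x) := by
    intro x
    ext i k
    simp [N, hg]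
  have key : ∀ x, MvPolynomial.eval x (N * N.transpose).det ≠ 0 ↔ LinearIndependent ℝ (f x) := by
    intro x
    have h1 : MvPolynomial.eval x (N * N.transpose).det
        = (Matrix.of (f x) * (Matrix.of (f x)).transpose).det := by
      rw [RingHom.map_det, RingHom.mapMatrix_apply, Matrix.map_mul, Matrix.transpose_map, hN]
    rw [h1, ← isUnit_iff_ne_zero, ← Matrix.isUnit_iff_isUnit_det]
    have h2 : LinearIndependent ℝ (f x) ↔ (Matrix.of (f x)).rank = Fintype.card ι := by
      rw [← Matrix.rank_transpose, Matrix.rank_eq_finrank_span_cols,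
        linearIndependent_iff_card_eq_finrank_span, eq_comm]
      rfl
    rw [h2, ← Matrix.rank_self_mul_transpose]
    constructor
    · intro hu
      exact Matrix.rank_of_isUnit _ hu
    · intro hr
      rw [← Matrix.linearIndependent_rows_iff_isUnit, linearIndependent_iff_card_eq_finrank_span,
        Set.finrank, ← Matrix.rank_eq_finrank_span_row, hr]
  refine eventually_genericFilter _ (fun h0 => ?_) fun x hx => (key x).1 hx
  exact (key x₀).2 h (by rw [h0, map_zero])

/-! ### Rado's theorem for subspaces -/

theorem Finset.sup_update_of_mem {α ι : Type*} [SemilatticeSup α] [OrderBot α] [DecidableEq ι]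
    (f : ι → α) {j : ι} {s : Finset ι} (hj : j ∈ s) (a : α) :
    s.sup (Function.update f j a) = a ⊔ (s.erase j).sup f := by
  conv_lhs => rw [← Finset.insert_erase hj]
  rw [Finset.sup_insert, Function.update_self]
  congr 1
  refine Finset.sup_congr rfl fun i hi => ?_
  rw [Function.update_of_ne (Finset.ne_of_mem_erase hi)]

/-- **Rado's theorem** for subspaces: if the sum of any `k` of the subspaces `D i` has dimension at
least `k`, then linearly independent vectors can be chosen, one in each `D i`. A subspace of
dimension at least two is the sum of two proper subspaces; by submodularity of the dimension it can
be replaced by one of them. -/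
theorem exists_linearIndependent_of_card_le_finrank_sup {K M ι : Type*} [Field K] [AddCommGroup M]
    [Module K M] [FiniteDimensional K M] [Finite ι] (D : ι → Submodule K M)
    (h : ∀ J : Finset ι, J.card ≤ Module.finrank K (J.sup D : Submodule K M)) :
    ∃ x : ι → M, (∀ i, x i ∈ D i) ∧ LinearIndependent K x := by
  classical
  have := Fintype.ofFinite ι
  induction hn : ∑ i, Module.finrank K (D i) using Nat.strong_induction_on generalizing D with
  | _ n ih =>
  by_cases hall : ∀ i, Module.finrank K (D i) ≤ 1
  · have h1 : ∀ i, ∃ x : M, D i = Submodule.span K {x} := by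
      intro i
      obtain ⟨v, hv⟩ := finrank_le_one_iff.1 (hall i)
      refine ⟨v, le_antisymm ?_ ?_⟩
      · intro w hw
        obtain ⟨c, hc⟩ := hv ⟨w, hw⟩
        exact Submodule.mem_span_singleton.2 ⟨c, by simpa using congrArg Subtype.val hc⟩
      · simp
    choose x hx using h1
    refine ⟨x, fun i => by rw [hx]; exact Submodule.mem_span_singleton_self _, ?_⟩
    rw [linearIndependent_iff_card_le_finrank_span]
    have h2 := h Finset.univ
    have h3 : Finset.univ.sup D = Submodule.span K (Set.range x) := by
      rw [Finset.sup_univ_eq_iSup, Submodule.span_range_eq_iSup]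
      exact iSup_congr hx
    rw [h3] at h2
    exact h2
  · push Not at hall
    obtain ⟨j, hj⟩ := hall
    have hne : D j ≠ ⊥ := by
      intro hb
      rw [hb, finrank_bot] at hj
      omega
    obtain ⟨x, hx, hx0⟩ := Submodule.exists_mem_ne_zero_of_ne_bot hne
    obtain ⟨C, hC⟩ := exists_isCompl (Submodule.span K {x})
    have hxle : Submodule.span K {x} ≤ D j := by simpa using hx
    have hlt1 : Submodule.span K {x} < D j := by
      refine lt_of_le_of_ne hxle fun he => ?_
      rw [← he, finrank_span_singleton hx0] at hj
      omega
    have hlt2 : C ⊓ D j < D j := by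
      refine lt_of_le_of_ne inf_le_right fun he => hx0 ?_
      have hxC : x ∈ C := (inf_eq_right.1 he) hx
      exact (Submodule.disjoint_def.1 hC.disjoint) x (Submodule.mem_span_singleton_self x) hxC
    have hsup : Submodule.span K {x} ⊔ C ⊓ D j = D j := by
      rw [← sup_inf_assoc_of_le C hxle, hC.sup_eq_top, top_inf_eq]
    have step : ∀ H : Submodule K M, H < D j →
        (∀ J : Finset ι, J.card ≤ Module.finrank K (J.sup (Function.update D j H) :
          Submodule K M)) → ∃ x : ι → M, (∀ i, x i ∈ D i) ∧ LinearIndependent K x := by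
      intro H hH hJ
      obtain ⟨y, hy, hy'⟩ := ih (∑ i, Module.finrank K (Function.update D j H i)) (by
        rw [← hn]
        refine Finset.sum_lt_sum (fun i _ => ?_) ⟨j, Finset.mem_univ _, ?_⟩
        · rcases eq_or_ne i j with rfl | hij
          · rw [Function.update_self]
            exact Submodule.finrank_mono hH.le
          · rw [Function.update_of_ne hij]
        · rw [Function.update_self]
          exact Submodule.finrank_lt_finrank_of_lt hH) _ hJ rfl
      refine ⟨y, fun i => ?_, hy'⟩
      rcases eq_or_ne i j with rfl | hij
      · have := hy i
        rw [Function.update_self] at this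
        exact hH.le this
      · simpa [Function.update_of_ne hij] using hy i
    by_contra hcon
    -- A set violating the condition after shrinking `D j` contains `j`.
    have viol : ∀ H : Submodule K M, H < D j → ∃ J : Finset ι, j ∈ J ∧
        Module.finrank K (H ⊔ (J.erase j).sup D : Submodule K M) < J.card := by
      intro H hH
      by_contra! hno
      refine hcon (step H hH fun J => ?_)
      by_cases hjJ : j ∈ J
      · rw [Finset.sup_update_of_mem D hjJ]
        exact hno J hjJ
      · have : J.sup (Function.update D j H) = J.sup D := by
          refine Finset.sup_congr rfl fun i hi => ?_
          rw [Function.update_of_ne]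
          rintro rfl
          exact hjJ hi
        rw [this]
        exact h J
    obtain ⟨J₁, hj₁, hJ₁⟩ := viol _ hlt1
    obtain ⟨J₂, hj₂, hJ₂⟩ := viol _ hlt2
    set A := Submodule.span K {x} ⊔ (J₁.erase j).sup D with hA
    set B := C ⊓ D j ⊔ (J₂.erase j).sup D with hB
    have e1 : (J₁ ∪ J₂).card ≤ Module.finrank K (A ⊔ B : Submodule K M) := by
      refine (h _).trans (Submodule.finrank_mono (Finset.sup_le fun i hi => ?_))
      rcases eq_or_ne i j with rfl | hij
      · rw [← hsup]
        exact sup_le_sup le_sup_left le_sup_left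
      · rcases Finset.mem_union.1 hi with hi | hi
        · exact le_trans (Finset.le_sup (f := D) (Finset.mem_erase.2 ⟨hij, hi⟩))
            (le_sup_right.trans le_sup_left)
        · exact le_trans (Finset.le_sup (f := D) (Finset.mem_erase.2 ⟨hij, hi⟩))
            (le_sup_right.trans le_sup_right)
    have e2 : ((J₁ ∩ J₂).erase j).card ≤ Module.finrank K (A ⊓ B : Submodule K M) := by
      refine (h _).trans (Submodule.finrank_mono (Finset.sup_le fun i hi => ?_))
      have hi' := Finset.mem_erase.1 hi
      have hi'' := Finset.mem_inter.1 hi'.2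
      exact le_inf
        ((Finset.le_sup (f := D) (Finset.mem_erase.2 ⟨hi'.1, hi''.1⟩)).trans le_sup_right)
        ((Finset.le_sup (f := D) (Finset.mem_erase.2 ⟨hi'.1, hi''.2⟩)).trans le_sup_right)
    rw [Finset.card_erase_of_mem (Finset.mem_inter.2 ⟨hj₁, hj₂⟩)] at e2
    have e3 := Submodule.finrank_sup_add_finrank_inf_eq A B
    have e4 := Finset.card_union_add_card_inter J₁ J₂
    omega

/-! ### Frameworks with pinned vertices -/

namespace LoopedSimpleGraph

variable {U : Type*} [DecidableEq U] {d : ℕ}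

theorem edgeEntry_mk (p : U → Fin d → ℝ) (w : U) (k : Fin d) (u v : U) :
    edgeEntry p w k s(u, v) =
      if w = u then p u k - p v k else if w = v then p v k - p u k else 0 := rfl

theorem edgeEntry_mk_left (p : U → Fin d → ℝ) (w : U) (k : Fin d) (v : U) :
    edgeEntry p w k s(w, v) = p w k - p v k := by
  simp [edgeEntry_mk]

theorem edgeEntry_of_notMem (p : U → Fin d → ℝ) {w : U} (k : Fin d) {e : Sym2 U} (h : w ∉ e) :
    edgeEntry p w k e = 0 := by
  induction e with
  | _ u v =>
    rw [Sym2.mem_iff, not_or] at h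
    simp [edgeEntry_mk, h.1, h.2]

theorem sum_mul_edgeEntry [Fintype U] (p : U → Fin d → ℝ) (ω : Sym2 U → ℝ) (w : U) (k : Fin d) :
    ∑ e, ω e * edgeEntry p w k e = ∑ v, ω s(w, v) * (p w k - p v k) := by
  have hinj : Function.Injective fun v : U => s(w, v) := fun a b h => Sym2.congr_right.1 h
  rw [← Finset.sum_subset (Finset.subset_univ (Finset.univ.image fun v : U => s(w, v)))]
  · rw [Finset.sum_image fun a _ b _ h => hinj h]
    exact Finset.sum_congr rfl fun v _ => by rw [edgeEntry_mk_left]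
  · intro e _ he
    rw [edgeEntry_of_notMem, mul_zero]
    rintro ⟨v, rfl⟩
    exact he (Finset.mem_image_of_mem _ (Finset.mem_univ v))

/-- The edges of `Γ` are independent in the framework `(Γ, p)` in which the vertices outside `X` are
pinned: the rows of the rigidity matrix, restricted to the columns of the vertices in `X`, are
linearly independent. -/
def RowsIndependent (Γ : SimpleGraph U) (X : Set U) (p : U → Fin d → ℝ) : Prop :=
  LinearIndependent ℝ fun (e : Γ.edgeSet) (c : X × Fin d) => edgeEntry p (c.1 : U) c.2 (e : Sym2 U)

/-- The edges are independent if and only if every stress in equilibrium at the vertices that are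
not pinned is zero. -/
theorem rowsIndependent_iff [Fintype U] {Γ : SimpleGraph U} {X : Set U} {p : U → Fin d → ℝ} :
    RowsIndependent Γ X p ↔ ∀ ω : Sym2 U → ℝ, (∀ e ∉ Γ.edgeSet, ω e = 0) →
      (∀ w ∈ X, ∑ v, ω s(w, v) • (p w - p v) = 0) → ∀ e, ω e = 0 := by
  classical
  have hsum : ∀ (ω : Sym2 U → ℝ), (∀ e ∉ Γ.edgeSet, ω e = 0) → ∀ w k,
      ∑ e : Γ.edgeSet, ω e * edgeEntry p w k (e : Sym2 U)
        = ∑ v, ω s(w, v) * (p w k - p v k) := by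
    intro ω hω w k
    rw [← sum_mul_edgeEntry, ← Finset.sum_subtype (Finset.univ.filter (· ∈ Γ.edgeSet)) (by simp)
      (fun e => ω e * edgeEntry p w k e)]
    exact Finset.sum_filter_of_ne fun e _ he => by_contra fun h => he (by rw [hω e h, zero_mul])
  rw [RowsIndependent, Fintype.linearIndependent_iff]
  constructor
  · intro h ω hω heq e
    by_cases he : e ∈ Γ.edgeSet
    · refine h (fun e => ω e) ?_ ⟨e, he⟩
      ext ⟨⟨w, hw⟩, k⟩
      have := congrFun (heq w hw) k
      simp only [Finset.sum_apply, Pi.smul_apply, Pi.sub_apply, smul_eq_mul, Pi.zero_apply] at this ⊢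
      rw [hsum ω hω, this]
    · exact hω e he
  · intro h g hg e
    have := h (fun e => if he : e ∈ Γ.edgeSet then g ⟨e, he⟩ else 0) (fun e he => by simp [he]) ?_ e
    · simpa using this
    · intro w hw
      ext k
      have h1 := congrFun hg (⟨w, hw⟩, k)
      have h2 := hsum (fun e => if he : e ∈ Γ.edgeSet then g ⟨e, he⟩ else 0)
        (fun e he => by simp [he]) w k
      simp only [Finset.sum_apply, Pi.smul_apply, Pi.sub_apply, smul_eq_mul, Pi.zero_apply,
        Subtype.coe_prop, dite_true, Subtype.coe_eta] at h1 h2 ⊢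
      rw [← h2, h1]

theorem eventually_rowsIndependent [Finite U] {Γ : SimpleGraph U} {X : Set U}
    {p₀ : U → Fin d → ℝ} (h : RowsIndependent Γ X p₀) :
    ∀ᶠ x in genericFilter (U × Fin d), RowsIndependent Γ X (Function.curry x) := by
  refine eventually_linearIndependent (fun (x : U × Fin d → ℝ) (e : Γ.edgeSet) (c : X × Fin d) =>
    edgeEntry (Function.curry x) (c.1 : U) c.2 (e : Sym2 U)) ?_ (x₀ := Function.uncurry p₀) h
  rintro ⟨e, -⟩ ⟨w, k⟩
  induction e with
  | _ u v =>
    refine ⟨if (w : U) = u then .X (u, k) - .X (v, k)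
      else if (w : U) = v then .X (v, k) - .X (u, k) else 0, fun x => ?_⟩
    rw [edgeEntry_mk]
    split_ifs <;> simp [Function.curry]

/-- Vertices at which no edge of `Γ` is incident may be released or pinned freely. -/
theorem RowsIndependent.of_support [Finite U] {Γ : SimpleGraph U} {X Y : Set U}
    {p : U → Fin d → ℝ} (h : RowsIndependent Γ X p) (hY : ∀ x ∈ X, x ∈ Γ.support → x ∈ Y) :
    RowsIndependent Γ Y p := by
  have := Fintype.ofFinite U
  rw [rowsIndependent_iff] at h ⊢
  intro ω hω heq
  refine h ω hω fun w hw => ?_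
  by_cases hs : w ∈ Γ.support
  · exact heq w (hY w hw hs)
  · refine Finset.sum_eq_zero fun v _ => ?_
    rw [hω, zero_smul]
    exact fun hadj => hs ⟨v, hadj⟩

theorem rowsIndependent_bot (X : Set U) (p : U → Fin d → ℝ) :
    RowsIndependent (⊥ : SimpleGraph U) X p := by
  have : IsEmpty (⊥ : SimpleGraph U).edgeSet := by simp
  exact linearIndependent_empty_type

/-- **0-extension**: a vertex of degree at most `d` can be added. -/
theorem eventually_rowsIndependent_of_ncard_neighborSet_le [Finite U] {Γ : SimpleGraph U}
    {X : Set U} {u : U} (hu : u ∈ X) (hdeg : (Γ.neighborSet u).ncard ≤ d)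
    (h : ∀ᶠ x in genericFilter (U × Fin d),
      RowsIndependent (Γ.deleteIncidenceSet u) X (Function.curry x)) :
    ∀ᶠ x in genericFilter (U × Fin d), RowsIndependent Γ X (Function.curry x) := by
  classical
  have := Fintype.ofFinite U
  -- Generically, the edge directions at `u` are linearly independent.
  have hind : ∀ᶠ x in genericFilter (U × Fin d), LinearIndependent ℝ
      fun (v : Γ.neighborSet u) (k : Fin d) => x (u, k) - x (v, k) := by
    obtain ⟨i⟩ : Nonempty (Γ.neighborSet u ↪ Fin d) := by
      rw [Function.Embedding.nonempty_iff_card_le, ← Nat.card_eq_fintype_card, Fintype.card_fin]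
      exact hdeg
    refine eventually_linearIndependent
      (fun (x : U × Fin d → ℝ) (v : Γ.neighborSet u) (k : Fin d) => x (u, k) - x (v, k))
      (fun v k => ⟨.X (u, k) - .X (v, k), fun x => by simp⟩)
      (x₀ := fun c => if hv : c.1 ∈ Γ.neighborSet u then
        - (Pi.single (i ⟨c.1, hv⟩) 1 : Fin d → ℝ) c.2 else 0) ?_
    have h1 := (Pi.linearIndependent_single_one (Fin d) ℝ).comp i i.injective
    convert h1 using 2 with v
    ext k
    simp
  filter_upwards [h, hind] with x hx hx'
  rw [rowsIndependent_iff] at hx ⊢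
  intro ω hω heq
  have h0 : ∀ v, ω s(u, v) = 0 := by
    intro v
    by_cases hv : v ∈ Γ.neighborSet u
    · rw [Fintype.linearIndependent_iff] at hx'
      refine hx' (fun v => ω s(u, v)) ?_ ⟨v, hv⟩
      have h1 := heq u hu
      rw [← Finset.sum_subset (Finset.subset_univ (Finset.univ.filter (· ∈ Γ.neighborSet u)))] at h1
      · rw [← h1]
        symm
        exact Finset.sum_subtype _ (by simp) _
      · intro y _ hy
        rw [hω, zero_smul]
        simpa using hy
    · exact hω _ hv
  refine hx ω (fun e he => ?_) heq
  by_cases hue : u ∈ e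
  · obtain ⟨v, rfl⟩ := hue
    exact h0 v
  · refine hω e fun heΓ => he ?_
    rw [SimpleGraph.edgeSet_deleteIncidenceSet]
    exact ⟨heΓ, fun hi => hue hi.2⟩

/-- **1-extension**: if `a` and `b` are nonadjacent neighbours of a vertex `v` of degree at most
`d + 1`, then `v` may be deleted and the edge `ab` added. Conversely `v` is put back at the midpoint
of `a` and `b`, where the edges `va` and `vb` together act as the edge `ab`. -/
theorem exists_rowsIndependent_of_one_extension [Finite U] {Γ : SimpleGraph U} {v a b : U}
    (hva : Γ.Adj v a) (hvb : Γ.Adj v b) (hab : a ≠ b) (hnab : ¬ Γ.Adj a b)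
    (hdeg : (Γ.neighborSet v).ncard ≤ d + 1)
    (h : ∃ p : U → Fin d → ℝ,
      RowsIndependent (Γ.deleteIncidenceSet v ⊔ SimpleGraph.edge a b) Set.univ p) :
    ∃ p : U → Fin d → ℝ, RowsIndependent Γ Set.univ p := by
  classical
  have := Fintype.ofFinite U
  obtain ⟨p₀, hp₀⟩ := h
  set N : Set U := Γ.neighborSet v \ {b} with hN
  have haN : a ∈ N := ⟨hva, hab⟩
  -- The directions at `v` other than that of `vb` are generically independent.
  have hind : ∀ᶠ x in genericFilter (U × Fin d), LinearIndependent ℝ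
      fun (w : N) (k : Fin d) => if (w : U) = a then x (a, k) - x (b, k)
        else (1 / 2) * (x (a, k) + x (b, k)) - x (w, k) := by
    obtain ⟨i⟩ : Nonempty (N ↪ Fin d) := by
      rw [Function.Embedding.nonempty_iff_card_le, ← Nat.card_eq_fintype_card, Fintype.card_fin]
      have h1 : N.ncard + 1 = (Γ.neighborSet v).ncard :=
        Set.ncard_sdiff_singleton_add_one (show b ∈ Γ.neighborSet v from hvb)
      change N.ncard ≤ d
      omega
    refine eventually_linearIndependent
      (fun (x : U × Fin d → ℝ) (w : N) (k : Fin d) => if (w : U) = a then x (a, k) - x (b, k)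
        else (1 / 2) * (x (a, k) + x (b, k)) - x (w, k))
      (fun w k => ⟨if (w : U) = a then .X (a, k) - .X (b, k)
        else .C (1 / 2) * (.X (a, k) + .X (b, k)) - .X (w, k), fun x => ?_⟩)
      (x₀ := fun c => if c.1 = a then (1 / 2) * (Pi.single (i ⟨a, haN⟩) 1 : Fin d → ℝ) c.2
        else if c.1 = b then - ((1 / 2) * (Pi.single (i ⟨a, haN⟩) 1 : Fin d → ℝ) c.2)
        else if hw : c.1 ∈ N then - (Pi.single (i ⟨c.1, hw⟩) 1 : Fin d → ℝ) c.2 else 0) ?_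
    · split_ifs <;> simp
    · have h1 := (Pi.linearIndependent_single_one (Fin d) ℝ).comp i i.injective
      convert h1 using 2 with w
      obtain ⟨w, hw⟩ := w
      have hwb : w ≠ b := hw.2
      ext k
      by_cases hwa : w = a
      · subst hwa
        simp [hab.symm]
        ring
      · simp [hwa, hab.symm, hwb, hw]
  obtain ⟨x, hx, hx'⟩ := ((eventually_rowsIndependent hp₀).and hind).exists
  set p := Function.curry x with hp
  set c : Fin d → ℝ := (1 / 2 : ℝ) • (p a + p b) with hc
  have hav : a ≠ v := hva.ne'
  have hbv : b ≠ v := hvb.ne'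
  refine ⟨Function.update p v c, ?_⟩
  rw [rowsIndependent_iff] at hx ⊢
  intro ω hω heq
  have hca : c - p a = -((1 / 2 : ℝ) • (p a - p b)) := by
    rw [hc]; module
  have hcb : c - p b = (1 / 2 : ℝ) • (p a - p b) := by
    rw [hc]; module
  -- Equilibrium at `v`.
  have hv0 : ∀ w : N, (if (w : U) = a then (1 / 2) * (ω s(v, b) - ω s(v, a)) else ω s(v, w)) = 0 := by
    rw [Fintype.linearIndependent_iff] at hx'
    apply hx'
    have h1 := heq v (Set.mem_univ v)
    have h2 : ∀ y, ω s(v, y) • (Function.update p v c v - Function.update p v c y)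
        = if y ∈ N then ω s(v, y) • (c - p y) else if y = b then ω s(v, y) • (c - p b) else 0 := by
      intro y
      by_cases hy : Γ.Adj v y
      · rw [Function.update_self, Function.update_of_ne hy.ne']
        by_cases hyb : y = b
        · subst hyb
          simp [hN]
        · rw [if_pos ⟨hy, hyb⟩]
      · rw [hω _ hy]
        simp
    have h3 : ∑ y, (if y = b then ω s(v, y) • (c - p b) else 0) = ω s(v, b) • (c - p b) := by simp
    have hbN : b ∉ N := fun hb => hb.2 rfl
    have h4 : ∑ y, ω s(v, y) • (Function.update p v c v - Function.update p v c y)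
        = ∑ y : N, ω s(v, y) • (c - p y) + ω s(v, b) • (c - p b) := by
      rw [← h3, ← Finset.sum_subtype (Finset.univ.filter (· ∈ N))
        (fun y => by rw [Finset.mem_filter, and_iff_right (Finset.mem_univ y)])
        (fun y => ω s(v, y) • (c - p y)), Finset.sum_filter, ← Finset.sum_add_distrib]
      refine Finset.sum_congr rfl fun y _ => ?_
      rw [h2]
      by_cases hyb : y = b
      · subst hyb
        simp [hbN]
      · simp [hyb]
    rw [h4] at h1
    have h5 : ω s(v, b) • (c - p b)
        = ∑ y : N, if (y : U) = a then ω s(v, b) • (c - p b) else 0 := by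
      rw [Finset.sum_eq_single (⟨a, haN⟩ : N)]
      · simp
      · rintro ⟨y, hy⟩ - hya
        rw [if_neg]
        rintro rfl
        exact hya rfl
      · simp
    rw [h5, ← Finset.sum_add_distrib] at h1
    rw [← h1]
    refine Finset.sum_congr rfl fun y _ => ?_
    by_cases hya : (y : U) = a
    · have h6 : (fun k => x (a, k) - x (b, k)) = p a - p b := rfl
      simp only [if_pos hya, h6]
      rw [hcb, hya, hca]
      module
    · have h6 : (fun k => (1 / 2) * (x (a, k) + x (b, k)) - x (y, k)) = c - p y := rfl
      simp only [if_neg hya, h6]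
      simp
  have hother : ∀ w, w ≠ a → w ≠ b → ω s(v, w) = 0 := by
    intro w hwa hwb
    by_cases hw : Γ.Adj v w
    · simpa [hwa] using hv0 ⟨w, hw, hwb⟩
    · exact hω _ hw
  have hvab : ω s(v, b) = ω s(v, a) := by
    have := hv0 ⟨a, haN⟩
    simp only [if_true] at this
    linarith
  have hωab : ω s(a, b) = 0 := hω _ hnab
  set ω' : Sym2 U → ℝ := fun e => if e = s(a, b) then ω s(v, a) / 2 else if v ∈ e then 0 else ω e
    with hω'
  have hzero : ∀ e, ω' e = 0 := by
    refine hx ω' (fun e he => ?_) fun w _ => ?_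
    · have h1 : e ≠ s(a, b) := by
        rintro rfl
        exact he (Or.inr ⟨rfl, hab⟩)
      simp only [hω', if_neg h1]
      split_ifs with hve
      · rfl
      · refine hω e fun heΓ => he ?_
        rw [SimpleGraph.edgeSet_sup, SimpleGraph.edgeSet_deleteIncidenceSet]
        exact Or.inl ⟨heΓ, fun hi => hve hi.2⟩
    · rcases eq_or_ne w v with rfl | hwv
      · refine Finset.sum_eq_zero fun y _ => ?_
        have h1 : s(w, y) ≠ s(a, b) := by
          intro h
          have : w ∈ s(a, b) := h ▸ Sym2.mem_mk_left w y
          rcases Sym2.mem_iff.1 this with h | h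
          · exact hav h.symm
          · exact hbv h.symm
        simp [hω', h1]
      · have h1 := heq w (Set.mem_univ w)
        rw [← sub_eq_zero, ← h1, ← Finset.sum_sub_distrib, h1]
        rw [Function.update_of_ne hwv]
        -- The two sums differ in the terms of `v` and of the other end of `ab` only.
        have hgen : ∀ y, y ≠ v → s(w, y) ≠ s(a, b) →
            ω' s(w, y) • (p w - p y) - ω s(w, y) • (p w - Function.update p v c y) = 0 := by
          intro y hy hne
          have : v ∉ s(w, y) := by
            rw [Sym2.mem_iff, not_or]
            exact ⟨hwv.symm, hy.symm⟩
          rw [Function.update_of_ne hy]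
          simp [hω', hne, this]
        have hnv : s(w, v) ≠ s(a, b) := by
          intro h
          have : v ∈ s(a, b) := h ▸ Sym2.mem_mk_right w v
          rcases Sym2.mem_iff.1 this with h | h
          · exact hav h.symm
          · exact hbv h.symm
        have hω'v : ω' s(w, v) = 0 := by simp [hω', hnv]
        rcases eq_or_ne w a with rfl | hwa
        · rw [Fintype.sum_eq_add v b hbv.symm]
          · have h2 : ω' s(w, b) = ω s(v, w) / 2 := by simp [hω']
            rw [hω'v, h2, hωab, Function.update_self, Sym2.eq_swap (a := w), ← neg_sub c, hca]
            module
          · rintro y ⟨hyv, hyb⟩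
            exact hgen y hyv fun h => hyb (Sym2.congr_right.1 h)
        · rcases eq_or_ne w b with rfl | hwb
          · rw [Fintype.sum_eq_add v a hav.symm]
            · have h2 : ω' s(w, a) = ω s(v, a) / 2 := by
                rw [Sym2.eq_swap]
                simp [hω']
              rw [hω'v, h2, Sym2.eq_swap (a := w) (b := a), hωab, Function.update_self,
                Sym2.eq_swap (a := w), ← neg_sub c, hcb, hvab]
              module
            · rintro y ⟨hyv, hya⟩
              refine hgen y hyv fun h => hya ?_
              rw [Sym2.eq_swap (a := a)] at h
              exact Sym2.congr_right.1 h
          · refine Finset.sum_eq_zero fun y _ => ?_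
            rcases eq_or_ne y v with rfl | hyv
            · rw [hω'v, Sym2.eq_swap, hother w hwa hwb]
              simp
            · refine hgen y hyv fun h => ?_
              have : w ∈ s(a, b) := h ▸ Sym2.mem_mk_left w y
              rcases Sym2.mem_iff.1 this with h | h
              · exact hwa h
              · exact hwb h
  have hωva : ω s(v, a) = 0 := by
    have := hzero s(a, b)
    simp only [hω', if_true] at this
    linarith
  intro e
  by_cases hve : v ∈ e
  · obtain ⟨w, rfl⟩ := hve
    by_cases hwa : w = a
    · rw [hwa, hωva]
    · by_cases hwb : w = b
      · rw [hwb, hvab, hωva]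
      · exact hother w hwa hwb
  · by_cases he : e = s(a, b)
    · rw [he, hωab]
    · simpa [hω', he, hve] using hzero e

end LoopedSimpleGraph

namespace LoopedSimpleGraph

variable {U : Type*} {d : ℕ}

/-! ### Independence of sparse graphs -/

theorem ncard_support_lt_of_subset_diff_singleton [Finite U] {Γ Γ' : SimpleGraph U} {v : U}
    (hv : v ∈ Γ.support) (h : Γ'.support ⊆ Γ.support \ {v}) :
    Γ'.support.ncard < Γ.support.ncard :=
  (Set.ncard_le_ncard h).trans_lt (Set.ncard_sdiff_singleton_lt_of_mem hv)

theorem ncard_neighborSet_mono [Finite U] {Γ Γ' : SimpleGraph U} (h : Γ' ≤ Γ) (v : U) :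
    (Γ'.neighborSet v).ncard ≤ (Γ.neighborSet v).ncard :=
  Set.ncard_le_ncard fun _ hw => h hw

/-- The graph obtained by deleting the edges at `v` and joining `a` to `b`. -/
def pinch (Γ : SimpleGraph U) (v a b : U) : SimpleGraph U :=
  Γ.deleteIncidenceSet v ⊔ SimpleGraph.edge a b

theorem pinch_adj {Γ : SimpleGraph U} {v a b x y : U} :
    (pinch Γ v a b).Adj x y ↔
      (Γ.Adj x y ∧ x ≠ v ∧ y ≠ v) ∨ ((x = a ∧ y = b ∨ x = b ∧ y = a) ∧ x ≠ y) := by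
  rw [pinch, SimpleGraph.sup_adj, SimpleGraph.deleteIncidenceSet_adj, SimpleGraph.edge_adj]

theorem adj_of_pinch_adj {Γ : SimpleGraph U} {v a b x y : U} (h : (pinch Γ v a b).Adj x y)
    (hxa : x ≠ a) (hxb : x ≠ b) : Γ.Adj x y := by
  rw [pinch_adj] at h
  tauto

theorem support_pinch_subset {Γ : SimpleGraph U} {v a b : U} (hva : Γ.Adj v a)
    (hvb : Γ.Adj v b) : (pinch Γ v a b).support ⊆ Γ.support \ {v} := by
  rintro x ⟨y, h⟩
  replace h := pinch_adj.1 h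
  rcases h with ⟨h, hx, -⟩ | ⟨⟨rfl, -⟩ | ⟨rfl, -⟩, -⟩
  · exact ⟨⟨y, h⟩, hx⟩
  · exact ⟨⟨v, hva.symm⟩, hva.ne'⟩
  · exact ⟨⟨v, hvb.symm⟩, hvb.ne'⟩

theorem ncard_neighborSet_pinch_le [Finite U] {Γ : SimpleGraph U} {v a b : U} (hva : Γ.Adj v a)
    (hvb : Γ.Adj v b) (x : U) :
    ((pinch Γ v a b).neighborSet x).ncard ≤ (Γ.neighborSet x).ncard := by
  have key : ∀ {a b : U}, Γ.Adj v a → ∀ S : Set U, S ⊆ insert b (Γ.neighborSet a \ {v}) →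
      S.ncard ≤ (Γ.neighborSet a).ncard := by
    intro a b hva S hS
    have h1 := Set.ncard_le_ncard hS
    have h2 := Set.ncard_insert_le b (Γ.neighborSet a \ {v})
    have h3 := Set.ncard_sdiff_singleton_add_one (show v ∈ Γ.neighborSet a from hva.symm)
    omega
  by_cases hxa : x = a
  · subst hxa
    refine key (b := b) hva _ fun y hy => ?_
    rcases pinch_adj.1 hy with h | h
    · exact Or.inr ⟨h.1, h.2.2⟩
    · left
      rcases h with ⟨h | h, hne⟩
      · exact h.2
      · exact absurd h.2.symm hne
  · by_cases hxb : x = b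
    · subst hxb
      refine key (b := a) hvb _ fun y hy => ?_
      rcases pinch_adj.1 hy with h | h
      · exact Or.inr ⟨h.1, h.2.2⟩
      · left
        rcases h with ⟨h | h, hne⟩
        · exact absurd h.2.symm hne
        · exact h.2
    · exact Set.ncard_le_ncard fun y hy => adj_of_pinch_adj hy hxa hxb

/-- A large clique created by joining `a` to `b` contains both. -/
theorem mem_of_isNClique_pinch {Γ : SimpleGraph U} {v a b : U} {n : ℕ} (hcf : Γ.CliqueFree n)
    {C : Finset U} (hC : (pinch Γ v a b).IsNClique n C) : a ∈ C ∧ b ∈ C := by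
  by_contra hno
  refine hcf C ⟨fun x hx y hy hxy => ?_, hC.card_eq⟩
  rcases pinch_adj.1 (hC.isClique hx hy hxy) with h | ⟨⟨rfl, rfl⟩ | ⟨rfl, rfl⟩, -⟩
  · exact h.1
  · exact absurd ⟨hx, hy⟩ hno
  · exact absurd ⟨hy, hx⟩ hno

/-- In a graph with degrees `d + 1` on its support and without `K_{d+2}`, some vertex `v` has two
nonadjacent neighbours `a`, `b` such that replacing `v` by the edge `ab` creates no `K_{d+2}`. If a
first choice of `v` fails because of a clique `C`, then any vertex of `C \ {a, b}` can be taken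
instead. -/
theorem exists_cliqueFree_pinch [Finite U] (hd : 2 ≤ d) {Γ : SimpleGraph U}
    (hdeg : ∀ u ∈ Γ.support, (Γ.neighborSet u).ncard = d + 1) (hcf : Γ.CliqueFree (d + 2))
    (hne : Γ.support.Nonempty) :
    ∃ v a b, Γ.Adj v a ∧ Γ.Adj v b ∧ a ≠ b ∧ ¬ Γ.Adj a b ∧
      (pinch Γ v a b).CliqueFree (d + 2) := by
  classical
  have := Fintype.ofFinite U
  obtain ⟨v, hv⟩ := hne
  obtain ⟨a, ha, b, hb, hab, hnab⟩ : ∃ a, Γ.Adj v a ∧ ∃ b, Γ.Adj v b ∧ a ≠ b ∧ ¬ Γ.Adj a b := by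
    by_contra! hall
    refine hcf (insert v (Γ.neighborFinset v)) ⟨?_, ?_⟩
    · rw [Finset.coe_insert, SimpleGraph.coe_neighborFinset, SimpleGraph.isClique_insert]
      exact ⟨fun a ha b hb hab => hall a ha b hb hab, fun b hb _ => hb⟩
    · rw [Finset.card_insert_of_notMem (by simp), SimpleGraph.card_neighborFinset_eq_degree,
        ← SimpleGraph.card_neighborSet_eq_degree, ← Nat.card_eq_fintype_card,
        Nat.card_coe_set_eq, hdeg v hv]
  by_cases hv1 : (pinch Γ v a b).CliqueFree (d + 2)
  · exact ⟨v, a, b, ha, hb, hab, hnab, hv1⟩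
  rw [SimpleGraph.CliqueFree] at hv1
  push Not at hv1
  obtain ⟨C, hC⟩ := hv1
  obtain ⟨haC, hbC⟩ := mem_of_isNClique_pinch hcf hC
  have hvC : v ∉ C := by
    intro hvC
    have := hC.isClique hvC haC ha.ne
    rw [pinch_adj] at this
    have h1 := ha.ne
    have h2 := hb.ne
    tauto
  set S := (C.erase a).erase b with hS
  have hScard : S.card = d := by
    rw [hS, Finset.card_erase_of_mem (Finset.mem_erase.2 ⟨hab.symm, hbC⟩),
      Finset.card_erase_of_mem haC, hC.card_eq]
    omega
  have hSmem : ∀ c, c ∈ S ↔ c ≠ b ∧ c ≠ a ∧ c ∈ C := by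
    intro c
    simp [hS]
  have hSadj : ∀ c ∈ S, ∀ x ∈ C, x ≠ c → Γ.Adj c x := by
    intro c hc x hx hxc
    rw [hSmem] at hc
    exact adj_of_pinch_adj (hC.isClique hc.2.2 hx hxc.symm) hc.2.1 hc.1
  -- The neighbours of `c ∈ S` are the other vertices of `C`, hence do not include `v`.
  have hSv : ∀ c ∈ S, ¬ Γ.Adj c v := by
    intro c hc hcv
    have hcC : c ∈ C := ((hSmem c).1 hc).2.2
    have h1 : (insert v (C.erase c)).card ≤ (Γ.neighborSet c).ncard := by
      rw [← Set.ncard_coe_finset]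
      refine Set.ncard_le_ncard fun x hx => ?_
      rcases Finset.mem_insert.1 (Finset.mem_coe.1 hx) with rfl | hx
      · exact hcv
      · rw [Finset.mem_erase] at hx
        exact hSadj c hc x hx.2 hx.1
    rw [Finset.card_insert_of_notMem (fun h => hvC (Finset.mem_of_mem_erase h)),
      Finset.card_erase_of_mem hcC, hC.card_eq, hdeg c ⟨v, hcv⟩] at h1
    omega
  have hNa : Γ.neighborSet a = ↑(insert v S) := by
    symm
    refine Set.eq_of_subset_of_ncard_le (fun x hx => ?_) ?_
    · rcases Finset.mem_insert.1 (Finset.mem_coe.1 hx) with rfl | hx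
      · exact ha.symm
      · exact (hSadj x hx a haC ((hSmem x).1 hx).2.1.symm).symm
    · rw [hdeg a ⟨v, ha.symm⟩, Set.ncard_coe_finset,
        Finset.card_insert_of_notMem (fun h => hvC ((hSmem v).1 h).2.2), hScard]
  obtain ⟨v', hv'⟩ : S.Nonempty := Finset.card_pos.1 (by omega)
  have hv'm := (hSmem v').1 hv'
  obtain ⟨c, hc⟩ : (S.erase v').Nonempty :=
    Finset.card_pos.1 (by rw [Finset.card_erase_of_mem hv']; omega)
  have hcS := Finset.mem_of_mem_erase hc
  have hcm := (hSmem c).1 hcS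
  refine ⟨v', a, b, hSadj v' hv' a haC hv'm.2.1.symm, hSadj v' hv' b hbC hv'm.1.symm, hab, hnab,
    fun C' hC' => ?_⟩
  obtain ⟨haC', hbC'⟩ := mem_of_isNClique_pinch hcf hC'
  -- A second clique `C'` would contain `v` and `c`, which are not adjacent.
  have hsub : (C'.erase a).erase b ⊆ insert v (S.erase v') := by
    intro x hx
    simp only [Finset.mem_erase] at hx
    have h1 := (pinch_adj.1 (hC'.isClique haC' hx.2.2 hx.2.1.symm))
    have h2 : Γ.Adj a x ∧ x ≠ v' := by tauto
    have h3 : x ∈ Γ.neighborSet a := h2.1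
    rw [hNa] at h3
    rcases Finset.mem_insert.1 (Finset.mem_coe.1 h3) with rfl | h3
    · exact Finset.mem_insert_self _ _
    · exact Finset.mem_insert_of_mem (Finset.mem_erase.2 ⟨h2.2, h3⟩)
  have heq := Finset.eq_of_subset_of_card_le hsub (by
    rw [Finset.card_erase_of_mem (Finset.mem_erase.2 ⟨hab.symm, hbC'⟩),
      Finset.card_erase_of_mem haC', hC'.card_eq]
    refine (Finset.card_insert_le _ _).trans ?_
    rw [Finset.card_erase_of_mem hv', hScard]
    omega)
  have hvC' : v ∈ C' := by
    have : v ∈ (C'.erase a).erase b := heq ▸ Finset.mem_insert_self _ _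
    exact Finset.mem_of_mem_erase (Finset.mem_of_mem_erase this)
  have hcC' : c ∈ C' := by
    have : c ∈ (C'.erase a).erase b := heq ▸ Finset.mem_insert_of_mem hc
    exact Finset.mem_of_mem_erase (Finset.mem_of_mem_erase this)
  refine hSv c hcS (adj_of_pinch_adj (hC'.isClique hcC' hvC' ?_) hcm.2.1 hcm.1)
  rintro rfl
  exact hvC hcm.2.2

variable [DecidableEq U]

/-- A graph with maximum degree at most `d + 1` and without `K_{d+2}` is independent in `ℝ^d`: a
vertex of smaller degree is removed by a 0-extension, and a regular graph is reduced by a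
1-extension. -/
theorem exists_rowsIndependent_of_cliqueFree [Finite U] (hd : 2 ≤ d) (Γ : SimpleGraph U)
    (hdeg : ∀ u, (Γ.neighborSet u).ncard ≤ d + 1) (hcf : Γ.CliqueFree (d + 2)) :
    ∃ p : U → Fin d → ℝ, RowsIndependent Γ Set.univ p := by
  induction hn : Γ.support.ncard using Nat.strong_induction_on generalizing Γ with
  | _ n ih =>
  subst hn
  by_cases hlow : ∃ u ∈ Γ.support, (Γ.neighborSet u).ncard ≤ d
  · obtain ⟨u, hu, hud⟩ := hlow
    have hle := Γ.deleteIncidenceSet_le u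
    obtain ⟨p, hp⟩ := ih _ (ncard_support_lt_of_subset_diff_singleton hu
      (Γ.support_deleteIncidenceSet_subset u)) (Γ.deleteIncidenceSet u)
      (fun w => (ncard_neighborSet_mono hle w).trans (hdeg w)) (hcf.anti hle) rfl
    obtain ⟨x, hx⟩ := (eventually_rowsIndependent_of_ncard_neighborSet_le (Set.mem_univ u) hud
      (eventually_rowsIndependent hp)).exists
    exact ⟨_, hx⟩
  · push Not at hlow
    rcases Γ.support.eq_empty_or_nonempty with he | hne
    · refine ⟨0, ?_⟩
      have : Γ = ⊥ := by
        ext x y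
        simp only [SimpleGraph.bot_adj, iff_false]
        intro h
        have : x ∈ Γ.support := ⟨y, h⟩
        rw [he] at this
        exact this
      subst this
      exact rowsIndependent_bot _ _
    · obtain ⟨v, a, b, hva, hvb, hab, hnab, hpcf⟩ := exists_cliqueFree_pinch hd
        (fun u hu => le_antisymm (hdeg u) (hlow u hu)) hcf hne
      refine exists_rowsIndependent_of_one_extension hva hvb hab hnab (hdeg v) ?_
      exact ih _ (ncard_support_lt_of_subset_diff_singleton ⟨a, hva⟩
        (support_pinch_subset hva hvb)) (pinch Γ v a b)
        (fun w => (ncard_neighborSet_pinch_le hva hvb w).trans (hdeg w)) hpcf rfl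

/-- If at most `t |Y|` edges meet `X` inside `Y` only, for each `Y ⊆ X`, where `2t ≤ d + 1`, then
the vertices of `X` that are not isolated have average degree at most `d + 1`. So one of them has
degree at most `d`, and can be removed by a 0-extension, or the graph is `(d+1)`-regular and has no
edge leaving `X`. -/
theorem eventually_rowsIndependent_of_sparse [Finite U] (hd : 2 ≤ d) {t : ℕ} (ht : 2 * t ≤ d + 1)
    (Γ : SimpleGraph U) (X : Finset U)
    (hsp : ∀ Y ⊆ X, {e | e ∈ Γ.edgeSet ∧ ∀ x ∈ e, x ∈ X → x ∈ Y}.ncard ≤ t * Y.card)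
    (hcf : Γ.CliqueFreeOn X (d + 2)) :
    ∀ᶠ x in genericFilter (U × Fin d), RowsIndependent Γ X (Function.curry x) := by
  classical
  have := Fintype.ofFinite U
  induction hn : Γ.support.ncard using Nat.strong_induction_on generalizing Γ with
  | _ n ih =>
  subst hn
  by_cases hlow : ∃ u ∈ X, u ∈ Γ.support ∧ (Γ.neighborSet u).ncard ≤ d
  · obtain ⟨u, huX, hu, hud⟩ := hlow
    have hle := Γ.deleteIncidenceSet_le u
    refine eventually_rowsIndependent_of_ncard_neighborSet_le huX hud
      (ih _ (ncard_support_lt_of_subset_diff_singleton hu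
        (Γ.support_deleteIncidenceSet_subset u)) (Γ.deleteIncidenceSet u) (fun Y hY => ?_)
        (SimpleGraph.CliqueFreeOn.anti _ _ hle hcf) rfl)
    refine le_trans (Set.ncard_le_ncard ?_) (hsp Y hY)
    exact fun e he => ⟨SimpleGraph.edgeSet_mono hle he.1, he.2⟩
  · push Not at hlow
    set Y := X.filter (· ∈ Γ.support) with hY
    have hdegree : ∀ u, (Γ.neighborSet u).ncard = Γ.degree u := by
      intro u
      rw [← SimpleGraph.card_neighborSet_eq_degree, ← Nat.card_eq_fintype_card,
        Nat.card_coe_set_eq]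
    have hE : Γ.edgeFinset.card ≤ t * Y.card := by
      refine le_trans (le_of_eq ?_) (hsp Y (Finset.filter_subset _ _))
      rw [← Set.ncard_coe_finset]
      congr 1
      ext e
      simp only [SimpleGraph.coe_edgeFinset, Set.mem_ofPred_eq, iff_self_and]
      rintro he x ⟨y, rfl⟩ hxX
      exact Finset.mem_filter.2 ⟨hxX, y, he⟩
    have hge : ∀ u ∈ (Finset.univ : Finset U), (if u ∈ Y then d + 1 else 0) ≤ Γ.degree u := by
      intro u _
      split_ifs with huY
      · have h1 := Finset.mem_filter.1 huY
        rw [← hdegree]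
        exact hlow u h1.1 h1.2
      · exact Nat.zero_le _
    have hsum : ∑ u, (if u ∈ Y then d + 1 else 0) = Y.card * (d + 1) := by
      rw [Finset.sum_ite_mem, Finset.univ_inter, Finset.sum_const, smul_eq_mul]
    have hsumle := Finset.sum_le_sum hge
    have htot := Γ.sum_degrees_eq_twice_card_edges
    have hreg := (Finset.sum_eq_sum_iff_of_le hge).1 (by
      refine le_antisymm hsumle ?_
      rw [hsum, htot]
      nlinarith)
    obtain ⟨p, hp⟩ := exists_rowsIndependent_of_cliqueFree hd Γ (fun u => by
      rw [hdegree, ← hreg u (Finset.mem_univ u)]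
      split_ifs <;> omega) (fun s hs => by
      refine hcf (fun x hx => ?_) hs
      obtain ⟨y, hy, hyx⟩ : ∃ y ∈ s, y ≠ x :=
        Finset.exists_mem_ne (by rw [hs.card_eq]; omega) x
      have hadj : Γ.Adj x y := hs.isClique hx hy hyx.symm
      by_contra hxX
      have h0 := hreg x (Finset.mem_univ x)
      rw [if_neg (fun h => hxX (Finset.mem_filter.1 h).1)] at h0
      have := (Γ.degree_pos_iff_exists_adj x).2 ⟨y, hadj⟩
      omega)
    refine eventually_rowsIndependent (hp.of_support fun x _ hx => ?_)
    by_contra hxX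
    obtain ⟨y, hy⟩ := hx
    have h0 := hreg x (Finset.mem_univ x)
    rw [if_neg (fun h => hxX (Finset.mem_filter.1 h).1)] at h0
    have := (Γ.degree_pos_iff_exists_adj x).2 ⟨y, hy⟩
    omega

/-! ### Choosing the velocity spaces -/

/-- The lengthening rates of the edges of `Γ` in the framework `(Γ, p)` when `u` moves with a given
velocity and all other vertices rest. -/
noncomputable def vertexMotion (Γ : SimpleGraph U) (p : U → Fin d → ℝ) (u : U) :
    (Fin d → ℝ) →ₗ[ℝ] (Γ.edgeSet → ℝ) :=
  Matrix.mulVecLin (Matrix.of fun (e : Γ.edgeSet) (k : Fin d) => edgeEntry p u k (e : Sym2 U))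

theorem vertexMotion_apply (Γ : SimpleGraph U) (p : U → Fin d → ℝ) (u : U) (m : Fin d → ℝ)
    (e : Γ.edgeSet) :
    vertexMotion Γ p u m e = ∑ k, edgeEntry p u k (e : Sym2 U) * m k := rfl

/-- If a subgraph `Γ'` is independent with the vertices outside `Y` pinned, then the motions of the
vertices in `Y` span a space of dimension at least `|E(Γ')|`. -/
theorem RowsIndependent.ncard_le_finrank [Finite U] {Γ Γ' : SimpleGraph U} (hle : Γ' ≤ Γ)
    {Y : Finset U} {p : U → Fin d → ℝ} (h : RowsIndependent Γ' Y p)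
    {S : Submodule ℝ (Γ.edgeSet → ℝ)} (hS : ∀ u ∈ Y, (vertexMotion Γ p u).range ≤ S) :
    Γ'.edgeSet.ncard ≤ Module.finrank ℝ S := by
  classical
  have := Fintype.ofFinite U
  let M : Matrix Γ'.edgeSet (↥(Y : Set U) × Fin d) ℝ :=
    Matrix.of fun e c => edgeEntry p (c.1 : U) c.2 (e : Sym2 U)
  have hrank : M.rank = Fintype.card Γ'.edgeSet := LinearIndependent.rank_matrix h
  let π : (Γ.edgeSet → ℝ) →ₗ[ℝ] (Γ'.edgeSet → ℝ) :=
    LinearMap.funLeft ℝ ℝ (Set.inclusion (SimpleGraph.edgeSet_mono hle))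
  have hrange : M.mulVecLin.range ≤ S.map π := by
    rintro _ ⟨z, rfl⟩
    refine ⟨∑ u : ↥(Y : Set U), vertexMotion Γ p u (fun k => z (u, k)),
      Submodule.sum_mem _ fun u _ => hS u u.2 ⟨_, rfl⟩, ?_⟩
    ext e
    rw [map_sum, Finset.sum_apply, Matrix.mulVecLin_apply, Matrix.mulVec, dotProduct,
      Fintype.sum_prod_type]
    rfl
  calc Γ'.edgeSet.ncard = M.rank := by
        rw [hrank, ← Nat.card_eq_fintype_card, Nat.card_coe_set_eq]
    _ ≤ Module.finrank ℝ (S.map π) := Submodule.finrank_mono hrange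
    _ ≤ Module.finrank ℝ S := Submodule.finrank_map_le π S

/-- The edges of a `t`-sparse graph with free vertex set `X` can be assigned to end-vertices in `X`
so that each vertex receives at most `t` edges, numbered from `0` to `t - 1`. -/
theorem exists_orientation [Finite U] {t : ℕ} (Γ : SimpleGraph U) (X : Finset U)
    (hsp : ∀ Y ⊆ X, {e | e ∈ Γ.edgeSet ∧ ∀ x ∈ e, x ∈ X → x ∈ Y}.ncard ≤ t * Y.card) :
    ∃ f : Γ.edgeSet → U × Fin t, Function.Injective f ∧
      ∀ e, (f e).1 ∈ X ∧ (f e).1 ∈ (e : Sym2 U) := by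
  classical
  have := Fintype.ofFinite U
  obtain ⟨f, hf, hfm⟩ := (Finset.all_card_le_biUnion_card_iff_exists_injective
    (fun e : Γ.edgeSet => (X.filter (· ∈ (e : Sym2 U))) ×ˢ (Finset.univ : Finset (Fin t)))).1 (by
    intro s
    set Y := X.filter fun x => ∃ e ∈ s, x ∈ (e : Sym2 U) with hY
    have h1 : (s.biUnion fun e : Γ.edgeSet =>
        (X.filter (· ∈ (e : Sym2 U))) ×ˢ (Finset.univ : Finset (Fin t))) = Y ×ˢ Finset.univ := by
      ext ⟨x, i⟩
      simp only [Finset.mem_biUnion, Finset.mem_product, Finset.mem_filter, Finset.mem_univ, hY]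
      tauto
    rw [h1, Finset.card_product, Finset.card_univ, Fintype.card_fin, mul_comm]
    refine le_trans ?_ (hsp Y (Finset.filter_subset _ _))
    rw [← Finset.card_image_of_injective s Subtype.val_injective, ← Set.ncard_coe_finset]
    refine Set.ncard_le_ncard fun e he => ?_
    obtain ⟨e', he', rfl⟩ := Finset.mem_image.1 (Finset.mem_coe.1 he)
    exact ⟨e'.2, fun x hx hxX => Finset.mem_filter.2 ⟨hxX, e', he', hx⟩⟩)
  refine ⟨f, hf, fun e => ?_⟩
  have := hfm e
  simp only [Finset.mem_product, Finset.mem_filter] at this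
  exact this.1

/-- For a `t`-tight graph on the free vertex set `X`, where `2t ≤ d + 1`, there are positions `p`
and `t` velocities at each free vertex such that the resulting motions form an independent family.
By Rado's theorem it suffices that the vertices of each `Y ⊆ X` span a motion space of dimension at
least `t |Y|`, and this holds because the edges assigned to `Y` are independent with the other
vertices pinned. -/
theorem exists_linearIndependent_vertexMotion [Finite U] (hd : 2 ≤ d) {t : ℕ}
    (ht : 2 * t ≤ d + 1) (Γ : SimpleGraph U) (X : Finset U)
    (hsp : ∀ Y ⊆ X, {e | e ∈ Γ.edgeSet ∧ ∀ x ∈ e, x ∈ X → x ∈ Y}.ncard ≤ t * Y.card)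
    (hcard : Γ.edgeSet.ncard = t * X.card) (hcf : Γ.CliqueFreeOn X (d + 2)) :
    ∃ (p : U → Fin d → ℝ) (a : X → Fin t → Fin d → ℝ),
      LinearIndependent ℝ fun j : X × Fin t => vertexMotion Γ p j.1 (a j.1 j.2) := by
  classical
  have := Fintype.ofFinite U
  obtain ⟨f, hf, hfm⟩ := exists_orientation Γ X hsp
  let E : Finset U → Set (Sym2 U) := fun Y => Subtype.val '' {e : Γ.edgeSet | (f e).1 ∈ Y}
  let Γ' : Finset U → SimpleGraph U := fun Y => SimpleGraph.fromEdgeSet (E Y)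
  have hE : ∀ Y, (Γ' Y).edgeSet = E Y := by
    intro Y
    rw [SimpleGraph.edgeSet_fromEdgeSet, sdiff_eq_left, Set.disjoint_left]
    rintro _ ⟨e, -, rfl⟩ hdiag
    exact Γ.not_isDiag_of_mem_edgeSet e.2 hdiag
  have hle : ∀ Y, Γ' Y ≤ Γ := by
    intro Y
    rw [← SimpleGraph.edgeSet_subset_edgeSet, hE]
    rintro _ ⟨e, -, rfl⟩
    exact e.2
  have himage : Finset.univ.image f = X ×ˢ Finset.univ := by
    refine Finset.eq_of_subset_of_card_le ?_ ?_
    · intro j hj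
      obtain ⟨e, -, rfl⟩ := Finset.mem_image.1 hj
      simpa using (hfm e).1
    · rw [Finset.card_image_of_injective _ hf, Finset.card_product, Finset.card_univ,
        Finset.card_univ, Fintype.card_fin, ← Nat.card_eq_fintype_card, Nat.card_coe_set_eq, hcard,
        mul_comm]
  have hEcard : ∀ Y ⊆ X, (Γ' Y).edgeSet.ncard = Y.card * t := by
    intro Y hY
    have h1 : f '' {e : Γ.edgeSet | (f e).1 ∈ Y} = ↑(Y ×ˢ (Finset.univ : Finset (Fin t))) := by
      ext j
      simp only [Set.mem_image, Set.mem_ofPred_eq, Finset.coe_product, Set.mem_prod,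
        Finset.mem_coe, Finset.coe_univ, Set.mem_univ, and_true]
      constructor
      · rintro ⟨e, he, rfl⟩
        exact he
      · intro hj
        have : j ∈ Finset.univ.image f := by
          rw [himage]
          simpa using hY hj
        obtain ⟨e, -, rfl⟩ := Finset.mem_image.1 this
        exact ⟨e, hj, rfl⟩
    rw [hE, Set.ncard_image_of_injective _ Subtype.val_injective,
      ← Set.ncard_image_of_injective _ hf, h1, Set.ncard_coe_finset, Finset.card_product,
      Finset.card_univ, Fintype.card_fin]
  have hind : ∀ Y : X.powerset, ∀ᶠ x in genericFilter (U × Fin d),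
      RowsIndependent (Γ' Y) (Y : Finset U) (Function.curry x) := by
    rintro ⟨Y, hY⟩
    rw [Finset.mem_powerset] at hY
    refine eventually_rowsIndependent_of_sparse hd ht (Γ' Y) Y (fun Z hZ => ?_)
      (SimpleGraph.CliqueFreeOn.subset _ (by exact_mod_cast hY)
        (SimpleGraph.CliqueFreeOn.anti _ _ (hle Y) hcf))
    have h2 := hEcard Z (hZ.trans hY)
    rw [mul_comm, ← h2, hE, hE]
    refine Set.ncard_le_ncard ?_
    rintro _ ⟨⟨e, he, rfl⟩, hx⟩
    exact ⟨e, hx _ (hfm e).2 he, rfl⟩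
  obtain ⟨x, hx⟩ := (Filter.eventually_all.2 hind).exists
  set p : U → Fin d → ℝ := Function.curry x
  obtain ⟨y, hy, hyi⟩ := exists_linearIndependent_of_card_le_finrank_sup
    (fun j : X × Fin t => (vertexMotion Γ p j.1).range) (by
    intro J
    set Y := J.image fun j => (j.1 : U) with hY
    have hYX : Y ⊆ X := by
      intro u hu
      obtain ⟨j, -, rfl⟩ := Finset.mem_image.1 hu
      exact j.1.2
    have h1 : J.card ≤ Y.card * t := by
      have h2 : J.card ≤ (Y ×ˢ (Finset.univ : Finset (Fin t))).card := by
        refine Finset.card_le_card_of_injOn (fun j => ((j.1 : U), j.2)) ?_ ?_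
        · intro j hj
          exact Finset.mem_product.2 ⟨Finset.mem_image_of_mem (fun j : X × Fin t => (j.1 : U)) hj,
            Finset.mem_univ _⟩
        · intro j _ j' _ h
          have h' : ((j.1 : U), j.2) = ((j'.1 : U), j'.2) := h
          exact Prod.ext (Subtype.ext (Prod.mk.inj h').1) (Prod.mk.inj h').2
      rwa [Finset.card_product, Finset.card_univ, Fintype.card_fin] at h2
    rw [← hEcard Y hYX] at h1
    refine h1.trans ((hx ⟨Y, Finset.mem_powerset.2 hYX⟩).ncard_le_finrank (hle Y) fun u hu => ?_)
    obtain ⟨j, hj, rfl⟩ := Finset.mem_image.1 hu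
    exact Finset.le_sup (f := fun j : X × Fin t => (vertexMotion Γ p j.1).range) hj)
  choose a ha using hy
  refine ⟨p, fun u i => a (u, i), ?_⟩
  rw [← funext ha] at hyi
  exact hyi

end LoopedSimpleGraph

namespace LoopedSimpleGraph

/-! ### Tight graphs are rigid -/

/-- A subspace of dimension `t` of `ℝ^d` is cut out by `d - t` linear equations. -/
theorem exists_equations_of_linearIndependent {d t s : ℕ} (hs : t + s = d)
    {a : Fin t → Fin d → ℝ} (ha : LinearIndependent ℝ a) :
    ∃ n : Fin s → Fin d → ℝ, ∀ m : Fin d → ℝ, (∀ j, ∑ k, n j k * m k = 0) →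
      ∃ c : Fin t → ℝ, ∑ i, c i • a i = m := by
  set W := Submodule.span ℝ (Set.range a) with hW
  have h1 : Module.finrank ℝ W = t := by
    rw [hW, finrank_span_eq_card ha, Fintype.card_fin]
  have h2 : Module.finrank ℝ ((Fin d → ℝ) ⧸ W) = s := by
    have := W.finrank_quotient_add_finrank
    rw [h1, Module.finrank_fin_fun] at this
    omega
  let b := Module.finBasisOfFinrankEq ℝ ((Fin d → ℝ) ⧸ W) h2
  refine ⟨fun j k => b.coord j (W.mkQ (Pi.single k 1)), fun m hm => ?_⟩
  have h3 : W.mkQ m = 0 := by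
    refine b.ext_elem fun j => ?_
    have h4 : (b.coord j ∘ₗ W.mkQ) m = ∑ k, b.coord j (W.mkQ (Pi.single k 1)) * m k := by
      rw [LinearMap.pi_apply_eq_sum_univ]
      refine Finset.sum_congr rfl fun k _ => ?_
      rw [smul_eq_mul, mul_comm, LinearMap.comp_apply]
      congr 3
      ext i
      simp [Pi.single_apply, eq_comm]
    rw [hm j] at h4
    simpa using h4
  have h5 : m ∈ W := by simpa using h3
  exact (Submodule.mem_span_range_iff_exists_fun ℝ).1 h5

variable {V L : Type*}

/-- The simple graph in which every loop of `G` is replaced by an edge from its base to a new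
vertex, named by the loop. With the new vertices pinned, the new edges act as loops. -/
def pinnedGraph (G : LoopedSimpleGraph V L) : SimpleGraph (V ⊕ L) where
  Adj
    | .inl u, .inl v => G.graph.Adj u v
    | .inl u, .inr l => G.base l = u
    | .inr l, .inl u => G.base l = u
    | .inr _, .inr _ => False
  symm := ⟨by
    rintro (u | l) (v | l') h
    · exact SimpleGraph.Adj.symm (G := G.graph) h
    · exact h
    · exact h
    · exact h⟩
  loopless := ⟨by
    rintro (u | l) h
    · exact SimpleGraph.irrefl G.graph h
    · exact h⟩

theorem pinnedGraph_edges_eq (G : LoopedSimpleGraph V L) (Z : Set V) :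
    {e | e ∈ G.pinnedGraph.edgeSet ∧ ∀ x : V, Sum.inl x ∈ e → x ∈ Z} =
      Sym2.map Sum.inl '' {e | e ∈ G.graph.edgeSet ∧ ∀ x ∈ e, x ∈ Z} ∪
        (fun l => s(Sum.inl (G.base l), Sum.inr l)) '' {l | G.base l ∈ Z} := by
  ext e
  constructor
  · induction e with
    | _ x y =>
    rintro ⟨hadj, hZ⟩
    rcases x with u | l <;> rcases y with v | l'
    · refine Or.inl ⟨s(u, v), ⟨hadj, fun x hx => hZ x ?_⟩, rfl⟩
      rcases Sym2.mem_iff.1 hx with rfl | rfl <;> simp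
    · obtain rfl : G.base l' = u := hadj
      exact Or.inr ⟨l', hZ _ (by simp), rfl⟩
    · obtain rfl : G.base l = v := hadj
      exact Or.inr ⟨l, hZ _ (by simp), Sym2.eq_swap⟩
    · exact hadj.elim
  · rintro (⟨e, ⟨he, hZ⟩, rfl⟩ | ⟨l, hl, rfl⟩)
    · induction e with
      | _ u v =>
      exact ⟨he, fun x hx => hZ x (by simpa using hx)⟩
    · refine ⟨rfl, fun x hx => ?_⟩
      have : x = G.base l := by simpa using hx
      exact this ▸ hl

theorem ncard_pinnedGraph_edges [Finite V] [Finite L] (G : LoopedSimpleGraph V L) (Z : Finset V) :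
    {e | e ∈ G.pinnedGraph.edgeSet ∧ ∀ x : V, Sum.inl x ∈ e → x ∈ (Z : Set V)}.ncard =
      G.inducedCount Z := by
  rw [pinnedGraph_edges_eq, Set.ncard_union_eq, Set.ncard_image_of_injective,
    Set.ncard_image_of_injective]
  · rfl
  · intro l l' h
    have h' : G.base l = G.base l' ∧ l = l' := by simpa using h
    exact h'.2
  · exact Sym2.map.injective Sum.inl_injective
  · rw [Set.disjoint_left]
    rintro _ ⟨e, -, rfl⟩ ⟨l, -, h⟩
    have : Sum.inr l ∈ Sym2.map (Sum.inl : V → V ⊕ L) e := h ▸ Sym2.mem_mk_right _ _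
    simp at this

theorem inducedCount_univ [Fintype V] (G : LoopedSimpleGraph V L) :
    G.inducedCount Finset.univ = G.graph.edgeSet.ncard + Nat.card L := by
  simp [inducedCount, Set.ncard_univ]

variable [DecidableEq V] {d : ℕ}

theorem rigidityMatrix_mulVec_inl [Fintype V] (G : LoopedSimpleGraph V L) (p : V → Fin d → ℝ)
    (q : L → Fin d → ℝ) (m : V × Fin d → ℝ) (e : G.graph.edgeSet) :
    (G.rigidityMatrix p q).mulVec m (Sum.inl e) =
      ∑ w, ∑ k, edgeEntry p w k (e : Sym2 V) * m (w, k) := by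
  rw [Matrix.mulVec, dotProduct, Fintype.sum_prod_type]
  rfl

theorem rigidityMatrix_mulVec_inr [Fintype V] (G : LoopedSimpleGraph V L) (p : V → Fin d → ℝ)
    (q : L → Fin d → ℝ) (m : V × Fin d → ℝ) (l : L) :
    (G.rigidityMatrix p q).mulVec m (Sum.inr l) = ∑ k, q l k * m (G.base l, k) := by
  rw [Matrix.mulVec, dotProduct, Fintype.sum_prod_type, Finset.sum_eq_single (G.base l)]
  · simp [rigidityMatrix]
  · intro w _ hw
    simp [rigidityMatrix, hw]
  · simp

theorem rank_eq_iff_forall_mulVec [Fintype V] (G : LoopedSimpleGraph V L) (p : V → Fin d → ℝ)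
    (q : L → Fin d → ℝ) :
    (G.rigidityMatrix p q).rank = d * Fintype.card V ↔
      ∀ m, (G.rigidityMatrix p q).mulVec m = 0 → m = 0 := by
  have h1 := (G.rigidityMatrix p q).mulVecLin.finrank_range_add_finrank_ker
  rw [Module.finrank_fintype_fun_eq_card, Fintype.card_prod, Fintype.card_fin, mul_comm] at h1
  have h2 : (∀ m, (G.rigidityMatrix p q).mulVec m = 0 → m = 0) ↔
      Module.finrank ℝ (G.rigidityMatrix p q).mulVecLin.ker = 0 := by
    rw [Submodule.finrank_eq_zero, LinearMap.ker_eq_bot']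
    rfl
  rw [h2, Matrix.rank]
  omega

/-- A `t`-tight looped graph without `K_{d+2}`, where `2t ≤ d + 1`, has a realisation and
`t`-dimensional velocity spaces, one at each vertex, such that no nonzero infinitesimal motion has
all its velocities in these spaces. -/
theorem exists_velocitySpaces [Fintype V] [Finite L] (hd : 2 ≤ d) {t : ℕ} (ht : 2 * t ≤ d + 1)
    (G : LoopedSimpleGraph V L) (hG : G.IsTight t) (hcf : G.graph.CliqueFree (d + 2)) :
    ∃ (p : V → Fin d → ℝ) (q : L → Fin d → ℝ) (a : V → Fin t → Fin d → ℝ),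
      ∀ c : V → Fin t → ℝ,
        (G.rigidityMatrix p q).mulVec (fun x => (∑ i, c x.1 i • a x.1 i) x.2) = 0 → c = 0 := by
  classical
  have := Fintype.ofFinite L
  set X : Finset (V ⊕ L) := Finset.univ.map Function.Embedding.inl with hX
  have hmemX : ∀ v : V, Sum.inl v ∈ X := fun v => by simp [hX]
  have hXcard : X.card = Fintype.card V := by rw [hX, Finset.card_map, Finset.card_univ]
  obtain ⟨P, a, ha⟩ := exists_linearIndependent_vertexMotion hd ht G.pinnedGraph X
    (fun Y hY => by
      set Z : Finset V := Finset.univ.filter fun v => Sum.inl v ∈ Y with hZ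
      have h1 : Z.card ≤ Y.card :=
        Finset.card_le_card_of_injOn Sum.inl (fun v hv => (Finset.mem_filter.1 hv).2)
          Sum.inl_injective.injOn
      refine le_trans ?_ ((hG.1 Z).trans (Nat.mul_le_mul_left t h1))
      rw [← ncard_pinnedGraph_edges]
      refine Set.ncard_le_ncard ?_
      rintro e ⟨he, hx⟩
      exact ⟨he, fun x hxe => by simpa [hZ] using hx _ hxe (hmemX x)⟩)
    (by
      rw [hXcard, ← Nat.card_eq_fintype_card, ← hG.2, ← inducedCount_univ,
        ← ncard_pinnedGraph_edges]
      congr 1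
      ext e
      simp)
    (fun s hs hcl => by
      refine hcf (Finset.univ.filter fun v => Sum.inl v ∈ s) ⟨fun u hu v hv huv => ?_, ?_⟩
      · exact hcl.isClique (Finset.mem_filter.1 hu).2 (Finset.mem_filter.1 hv).2
          (Sum.inl_injective.ne huv)
      · rw [← hcl.card_eq, ← Finset.card_map Function.Embedding.inl]
        congr 1
        ext x
        rw [Finset.mem_map]
        constructor
        · rintro ⟨v, hv, rfl⟩
          exact (Finset.mem_filter.1 hv).2
        · intro hx
          obtain ⟨v, -, rfl⟩ := Finset.mem_map.1 (hs hx)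
          exact ⟨v, Finset.mem_filter.2 ⟨Finset.mem_univ _, hx⟩, rfl⟩)
  refine ⟨fun v => P (Sum.inl v), fun l k => P (Sum.inl (G.base l)) k - P (Sum.inr l) k,
    fun v => a ⟨Sum.inl v, hmemX v⟩, fun c hc => ?_⟩
  set m : V × Fin d → ℝ := fun x => (∑ i, c x.1 i • a ⟨Sum.inl x.1, hmemX x.1⟩ i) x.2 with hm
  let φ : V × Fin t → X × Fin t := fun j => (⟨Sum.inl j.1, hmemX j.1⟩, j.2)
  have hφ : Function.Injective φ := by
    rintro ⟨v, i⟩ ⟨v', i'⟩ h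
    simpa [φ] using h
  have hli := ha.comp φ hφ
  rw [Fintype.linearIndependent_iff] at hli
  have key := hli (fun j => c j.1 j.2) ?_
  · ext v i
    exact key (v, i)
  -- The motion `m` lengthens no edge of the pinned graph.
  have hlen : ∑ j : V × Fin t, c j.1 j.2 • vertexMotion G.pinnedGraph P (Sum.inl j.1)
      (a ⟨Sum.inl j.1, hmemX j.1⟩ j.2) = ∑ v, vertexMotion G.pinnedGraph P (Sum.inl v)
        (fun k => m (v, k)) := by
    rw [Fintype.sum_prod_type]
    refine Finset.sum_congr rfl fun v _ => ?_
    have : (fun k => m (v, k)) = ∑ i, c v i • a ⟨Sum.inl v, hmemX v⟩ i := rfl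
    rw [this, map_sum]
    exact Finset.sum_congr rfl fun i _ => by rw [map_smul]
  refine Eq.trans hlen ?_
  ext ⟨e, he⟩
  rw [Finset.sum_apply, Pi.zero_apply]
  simp only [vertexMotion_apply]
  have hcases := (pinnedGraph_edges_eq G Set.univ).subset ⟨he, fun _ _ => Set.mem_univ _⟩
  rcases hcases with ⟨e', ⟨he', -⟩, rfl⟩ | ⟨l, -, rfl⟩
  · have h1 := congrFun hc (Sum.inl ⟨e', he'⟩)
    rw [rigidityMatrix_mulVec_inl] at h1
    refine Eq.trans (Finset.sum_congr rfl fun v _ => Finset.sum_congr rfl fun k _ => ?_) h1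
    congr 1
    induction e' with
    | _ x y =>
    rw [Sym2.map_mk]
    simp [edgeEntry_mk]
  · have h1 := congrFun hc (Sum.inr l)
    rw [rigidityMatrix_mulVec_inr] at h1
    rw [Finset.sum_eq_single (G.base l)]
    · refine Eq.trans (Finset.sum_congr rfl fun k _ => ?_) h1
      rw [edgeEntry_mk_left]
    · intro v _ hv
      refine Finset.sum_eq_zero fun k _ => ?_
      rw [edgeEntry_of_notMem, zero_mul]
      simpa using hv
    · simp

theorem exists_loops_of_le_loopCount [Finite L] (G : LoopedSimpleGraph V L) {s : ℕ}
    (h : ∀ x, s ≤ G.loopCount x) :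
    ∃ g : V × Fin s → L, Function.Injective g ∧ ∀ j, G.base (g j) = j.1 := by
  classical
  have := Fintype.ofFinite L
  have h1 : ∀ x, Nonempty (Fin s ↪ {l : L | G.base l = x}) := by
    intro x
    rw [Function.Embedding.nonempty_iff_card_le, Fintype.card_fin, ← Nat.card_eq_fintype_card,
      Nat.card_coe_set_eq]
    exact h x
  let g' : ∀ x, Fin s ↪ {l : L | G.base l = x} := fun x => (h1 x).some
  have hb : ∀ x j, G.base (g' x j : L) = x := fun x j => (g' x j).2
  refine ⟨fun j => g' j.1 j.2, ?_, fun j => hb _ _⟩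
  rintro ⟨x, j⟩ ⟨x', j'⟩ hxj
  have hx : x = x' := by
    rw [← hb x j, ← hb x' j']
    exact congrArg G.base hxj
  subst hx
  exact Prod.ext rfl ((g' x).injective (Subtype.ext hxj))

/-- A `d`-tight graph without `K_{d+2}` is rigid if it has `d / 2` loops at each vertex. Without
these loops it is `(d - d / 2)`-tight, and they can be realised by the equations of the velocity
space at their vertex. -/
theorem IsTight.isRigid [Fintype V] [Finite L] (hd : 2 ≤ d) (G : LoopedSimpleGraph V L)
    (hG : G.IsTight d) (hcf : G.graph.CliqueFree (d + 2)) (hl : ∀ x, d / 2 ≤ G.loopCount x) :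
    G.IsRigid d := by
  classical
  have := Fintype.ofFinite L
  obtain ⟨g, hg, hgb⟩ := G.exists_loops_of_le_loopCount hl
  -- The loops set aside are those in the range of `g`.
  let G' : LoopedSimpleGraph V {l : L // l ∉ Set.range g} := ⟨G.graph, fun l => G.base l⟩
  have hcount : ∀ X : Finset V, G.inducedCount X = G'.inducedCount X + (d / 2) * X.card := by
    intro X
    have h1 : {l : L | G.base l ∈ X} = Subtype.val '' {l : {l : L // l ∉ Set.range g} |
        G'.base l ∈ X} ∪ g '' ↑(X ×ˢ (Finset.univ : Finset (Fin (d / 2)))) := by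
      ext l
      constructor
      · intro hlX
        by_cases hlg : l ∈ Set.range g
        · obtain ⟨j, rfl⟩ := hlg
          refine Or.inr ⟨j, ?_, rfl⟩
          have : j.1 ∈ X := hgb j ▸ hlX
          simpa using this
        · exact Or.inl ⟨⟨l, hlg⟩, hlX, rfl⟩
      · rintro (⟨l, hlX, rfl⟩ | ⟨j, hj, rfl⟩)
        · exact hlX
        · change G.base (g j) ∈ X
          rw [hgb]
          simpa using hj
    rw [inducedCount, inducedCount, h1, Set.ncard_union_eq, Set.ncard_image_of_injective _ hg,
      Set.ncard_image_of_injective _ Subtype.val_injective, Set.ncard_coe_finset,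
      Finset.card_product, Finset.card_univ, Fintype.card_fin, mul_comm X.card, add_assoc]
    rw [Set.disjoint_left]
    rintro _ ⟨l, -, rfl⟩ ⟨j, -, hj⟩
    exact l.2 ⟨j, hj⟩
  have hsplit : ∀ n : ℕ, d * n = (d - d / 2) * n + (d / 2) * n := by
    intro n
    rw [← add_mul]
    congr 1
    omega
  have hG' : G'.IsTight (d - d / 2) := by
    constructor
    · intro X
      have h1 := hG.1 X
      rw [hcount, hsplit] at h1
      omega
    · have h1 := hG.2
      rw [← inducedCount_univ, hcount, hsplit, Finset.card_univ, ← Nat.card_eq_fintype_card] at h1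
      rw [← inducedCount_univ]
      omega
  obtain ⟨p, q, a, ha⟩ := exists_velocitySpaces hd (by omega) G' hG' hcf
  have hli : ∀ v, LinearIndependent ℝ (a v) := by
    intro v
    rw [Fintype.linearIndependent_iff]
    intro c hc
    have hz : (fun x : V × Fin d =>
        (∑ i, (Pi.single v c : V → Fin (d - d / 2) → ℝ) x.1 i • a x.1 i) x.2) = 0 := by
      ext ⟨w, k⟩
      rcases eq_or_ne w v with rfl | hw
      · simp only [Pi.single_eq_same, hc]
        rfl
      · simp [Pi.single_eq_of_ne hw]
    have h1 := ha (Pi.single v c) (by rw [hz, Matrix.mulVec_zero])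
    intro i
    have := congrFun (congrFun h1 v) i
    simpa using this
  choose n hn using fun v => exists_equations_of_linearIndependent (s := d / 2) (by omega) (hli v)
  let q' : L → Fin d → ℝ := Function.extend g (fun j => n j.1 j.2)
    (fun l => if h : l ∉ Set.range g then q ⟨l, h⟩ else 0)
  refine ⟨p, q', (rank_eq_iff_forall_mulVec G p q').2 fun m hm => ?_⟩
  have hspace : ∀ v, ∃ c : Fin (d - d / 2) → ℝ, ∑ i, c i • a v i = fun k => m (v, k) := by
    intro v
    refine hn v _ fun j => ?_
    have h1 := congrFun hm (Sum.inr (g (v, j)))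
    rw [rigidityMatrix_mulVec_inr, hgb] at h1
    simp only [q', hg.extend_apply] at h1
    exact h1
  choose c hc using hspace
  have hmc : (fun x : V × Fin d => (∑ i, c x.1 i • a x.1 i) x.2) = m := by
    ext ⟨v, k⟩
    exact congrFun (hc v) k
  have hc0 := ha c (by
    rw [hmc]
    ext (e | l)
    · have h1 := congrFun hm (Sum.inl e)
      rw [rigidityMatrix_mulVec_inl] at h1 ⊢
      exact h1
    · have h1 := congrFun hm (Sum.inr l.1)
      rw [rigidityMatrix_mulVec_inr] at h1 ⊢
      have hl : q' l.1 = q l := by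
        have := l.2
        simp only [q']
        rw [Function.extend_apply' _ _ _ (by simpa using this), dif_pos this]
      rw [hl] at h1
      exact h1)
  rw [← hmc, hc0]
  ext x
  simp

theorem SpanningSubgraph.isRigid [Fintype V] {G : LoopedSimpleGraph V L} (H : G.SpanningSubgraph)
    (h : H.toLooped.IsRigid d) : G.IsRigid d := by
  classical
  obtain ⟨p, q, hpq⟩ := h
  rw [rank_eq_iff_forall_mulVec] at hpq
  let q' : L → Fin d → ℝ := fun l => if h : l ∈ H.loops then q ⟨l, h⟩ else 0
  refine ⟨p, q', (rank_eq_iff_forall_mulVec G p q').2 fun m hm => hpq m ?_⟩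
  ext (e | l)
  · have h1 := congrFun hm (Sum.inl ⟨e, SimpleGraph.edgeSet_mono H.graph_le e.2⟩)
    rw [rigidityMatrix_mulVec_inl] at h1 ⊢
    exact h1
  · have h1 := congrFun hm (Sum.inr l.1)
    rw [rigidityMatrix_mulVec_inr] at h1 ⊢
    have hl : q' l.1 = q l := dif_pos l.2
    rw [hl] at h1
    exact h1

end LoopedSimpleGraph

namespace LoopedSimpleGraph

variable {V L : Type*} [DecidableEq V] {d : ℕ}

/-! ### Rigid graphs have tight subgraphs -/

/-- A rigid graph has a realisation of full rank in which the rows of `s ≤ d` chosen loops at each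
vertex are linearly independent: both properties hold for generic `q`. -/
theorem IsRigid.exists_linearIndependent_loops [Fintype V] [Finite L] {G : LoopedSimpleGraph V L}
    (h : G.IsRigid d) {s : ℕ} (hs : s ≤ d) {g : V × Fin s → L} (hg : Function.Injective g)
    (hgb : ∀ j, G.base (g j) = j.1) :
    ∃ (p : V → Fin d → ℝ) (q : L → Fin d → ℝ),
      (G.rigidityMatrix p q).rank = d * Fintype.card V ∧
        LinearIndependent ℝ fun j => (G.rigidityMatrix p q).row (Sum.inr (g j)) := by
  classical
  have := Fintype.ofFinite L
  obtain ⟨p, q, hpq⟩ := h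
  have hpoly : ∀ r c, ∃ f : MvPolynomial (L × Fin d) ℝ, ∀ x, MvPolynomial.eval x f =
      G.rigidityMatrix p (Function.curry x) r c := by
    rintro (e | l) ⟨w, k⟩
    · exact ⟨.C (edgeEntry p w k (e : Sym2 V)), fun x => by simp [rigidityMatrix]⟩
    · refine ⟨if w = G.base l then .X (l, k) else 0, fun x => ?_⟩
      by_cases hw : w = G.base l <;> simp [rigidityMatrix, hw, Function.curry]
  have hcols : ∀ q : L → Fin d → ℝ, (G.rigidityMatrix p q).rank = d * Fintype.card V ↔
      LinearIndependent ℝ (G.rigidityMatrix p q).col := by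
    intro q
    rw [rank_eq_iff_forall_mulVec, ← Matrix.mulVec_injective_iff]
    exact (injective_iff_map_eq_zero (G.rigidityMatrix p q).mulVecLin).symm
  have h1 : ∀ᶠ x in genericFilter (L × Fin d),
      LinearIndependent ℝ (G.rigidityMatrix p (Function.curry x)).col :=
    eventually_linearIndependent
      (fun (x : L × Fin d → ℝ) => (G.rigidityMatrix p (Function.curry x)).col)
      (fun c r => hpoly r c) (x₀ := Function.uncurry q) ((hcols q).1 hpq)
  -- Independent rows are obtained by giving distinct loops at a vertex distinct unit vectors.
  have h2 : ∀ᶠ x in genericFilter (L × Fin d),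
      LinearIndependent ℝ fun j => (G.rigidityMatrix p (Function.curry x)).row (Sum.inr (g j)) := by
    refine eventually_linearIndependent
      (fun (x : L × Fin d → ℝ) j => (G.rigidityMatrix p (Function.curry x)).row (Sum.inr (g j)))
      (fun j c => hpoly _ c)
      (x₀ := Function.uncurry (Function.extend g
        (fun j => (Pi.single (Fin.castLE hs j.2) 1 : Fin d → ℝ)) 0)) ?_
    have hinj : Function.Injective fun j : V × Fin s => (j.1, Fin.castLE hs j.2) := by
      rintro ⟨v, i⟩ ⟨v', i'⟩ h
      simpa using h
    have h3 := (Pi.linearIndependent_single_one (V × Fin d) ℝ).comp _ hinj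
    convert h3 using 2 with j
    ext ⟨w, k⟩
    simp only [Matrix.row, rigidityMatrix, Matrix.of_apply, hgb, Function.curry_uncurry,
      hg.extend_apply, Function.comp_apply, Pi.single_apply, Prod.mk.injEq]
    split_ifs <;> simp_all
  obtain ⟨x, hx1, hx2⟩ := (h1.and h2).exists
  exact ⟨p, _, (hcols _).2 hx1, hx2⟩

/-- Independent vectors of `ℝ^(V × d)` vanishing outside `X` are at most `d |X|` in number. -/
theorem ncard_le_of_linearIndepOn {ι : Type*} [Finite V] {f : ι → V × Fin d → ℝ} {b : Set ι}
    (hb : LinearIndepOn ℝ f b) (X : Finset V) (hX : ∀ i ∈ b, ∀ c, c.1 ∉ X → f i c = 0) :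
    b.ncard ≤ d * X.card := by
  classical
  have := Fintype.ofFinite V
  let ρ : (V × Fin d → ℝ) →ₗ[ℝ] (X × Fin d → ℝ) := LinearMap.funLeft ℝ ℝ fun c => (c.1, c.2)
  have h1 : LinearIndependent ℝ fun i : b => ρ (f i) := by
    rw [linearIndependent_iff']
    intro s g hg
    refine linearIndependent_iff'.1 hb s g ?_
    ext ⟨w, k⟩
    rw [Finset.sum_apply, Pi.zero_apply]
    by_cases hw : w ∈ X
    · have := congrFun hg (⟨w, hw⟩, k)
      rw [Finset.sum_apply] at this
      exact this
    · refine Finset.sum_eq_zero fun i _ => ?_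
      rw [Pi.smul_apply, hX i i.2 (w, k) hw, smul_zero]
  have := h1.finite
  have := Fintype.ofFinite b
  have h2 := h1.fintype_card_le_finrank
  rw [Module.finrank_fintype_fun_eq_card, Fintype.card_prod, Fintype.card_fin, Fintype.card_coe,
    ← Nat.card_eq_fintype_card, Nat.card_coe_set_eq] at h2
  linarith [mul_comm d X.card]

/-- The edges of `K_{d+2}` are dependent: an affine dependence `λ` of `d + 2` points gives the
stress `λ_u λ_v`. -/
theorem cliqueFree_of_rowsIndependent [Finite V] {Γ : SimpleGraph V} {p : V → Fin d → ℝ}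
    (h : RowsIndependent Γ Set.univ p) : Γ.CliqueFree (d + 2) := by
  classical
  have := Fintype.ofFinite V
  intro C hC
  have hdep : ¬ LinearIndependent ℝ fun v : C => ((p v, 1) : (Fin d → ℝ) × ℝ) := by
    intro hli
    have := hli.fintype_card_le_finrank
    rw [Module.finrank_prod, Module.finrank_fin_fun, Module.finrank_self, Fintype.card_coe,
      hC.card_eq] at this
    omega
  rw [Fintype.not_linearIndependent_iff] at hdep
  obtain ⟨μ, hμ, i, hi⟩ := hdep
  let lam : V → ℝ := fun v => if hv : v ∈ C then μ ⟨v, hv⟩ else 0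
  have hlamC : ∀ v, v ∉ C → lam v = 0 := fun v hv => dif_neg hv
  have hlam : ∀ v : C, lam v = μ v := fun v => dif_pos v.2
  have hextend : ∀ {M : Type} [AddCommGroup M] [Module ℝ M] (f : V → M),
      ∑ v, lam v • f v = ∑ v : C, μ v • f v := by
    intro M _ _ f
    rw [← Finset.sum_subset (Finset.subset_univ C), ← Finset.sum_coe_sort C]
    · exact Finset.sum_congr rfl fun v _ => by rw [hlam]
    · intro v _ hv
      rw [hlamC v hv, zero_smul]
  have hsum0 : ∑ v, lam v = 0 := by
    have h1 := hextend (fun _ : V => (1 : ℝ))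
    have h2 := congrArg Prod.snd hμ
    simp only [Prod.snd_sum, Prod.snd_zero, Prod.smul_snd] at h2
    rw [h2] at h1
    simpa using h1
  have hsump : ∑ v, lam v • p v = 0 := by
    have h2 := congrArg Prod.fst hμ
    simp only [Prod.fst_sum, Prod.fst_zero, Prod.smul_fst] at h2
    rw [hextend, h2]
  let ω : Sym2 V → ℝ := Sym2.lift ⟨fun u v => if u = v then 0 else lam u * lam v, fun u v => by
    simp only [eq_comm (a := u), mul_comm]⟩
  have hω : ∀ u v, ω s(u, v) = if u = v then 0 else lam u * lam v := fun u v => rfl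
  have hzero := (rowsIndependent_iff.1 h) ω ?_ ?_
  · obtain ⟨j, hj, hj0⟩ : ∃ j, j ≠ (i : V) ∧ lam j ≠ 0 := by
      by_contra! hall
      rw [Finset.sum_eq_single (i : V) (fun j _ hj => hall j hj) (by simp), hlam] at hsum0
      exact hi hsum0
    have := hzero s((i : V), j)
    rw [hω, if_neg hj.symm, hlam] at this
    exact mul_ne_zero hi hj0 this
  · intro e he
    induction e with
    | _ u v =>
    rw [hω]
    split_ifs with huv
    · rfl
    · by_contra hne
      refine he (hC.isClique (by_contra fun hu => hne ?_) (by_contra fun hv => hne ?_) huv)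
      · rw [hlamC u hu, zero_mul]
      · rw [hlamC v hv, mul_zero]
  · intro w _
    have h1 : ∀ v, ω s(w, v) • (p w - p v) = lam w • (lam v • p w - lam v • p v) := by
      intro v
      rw [hω]
      split_ifs with hwv
      · subst hwv
        simp
      · module
    rw [Finset.sum_congr rfl fun v _ => h1 v, ← Finset.smul_sum, Finset.sum_sub_distrib,
      ← Finset.sum_smul, hsum0, hsump]
    simp

/-- A basis of the row space that extends the rows of the chosen loops is the required subgraph. -/
theorem IsRigid.exists_isTight [Fintype V] [Finite L] {G : LoopedSimpleGraph V L}
    (h : G.IsRigid d) {s : ℕ} (hs : s ≤ d) (hl : ∀ x, s ≤ G.loopCount x) :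
    ∃ H : G.SpanningSubgraph, H.toLooped.IsTight d ∧ H.toLooped.graph.CliqueFree (d + 2) ∧
      ∀ x, s ≤ H.toLooped.loopCount x := by
  classical
  have := Fintype.ofFinite L
  obtain ⟨g, hg, hgb⟩ := G.exists_loops_of_le_loopCount hl
  obtain ⟨p, q, hrank, hli⟩ := h.exists_linearIndependent_loops hs hg hgb
  set M := G.rigidityMatrix p q with hM
  have hli' : LinearIndepOn ℝ M.row (Set.range fun j => Sum.inr (g j)) :=
    (linearIndepOn_range_iff (Sum.inr_injective.comp hg) _).2 hli
  obtain ⟨b, -, hsb, hspan, hb⟩ := exists_linearIndepOn_extension hli' (Set.subset_univ _)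
  have hbcard : b.ncard = d * Fintype.card V := by
    have h1 : Submodule.span ℝ (Set.range M.row) = Submodule.span ℝ (M.row '' b) := by
      refine le_antisymm (Submodule.span_le.2 ?_) (Submodule.span_mono (Set.image_subset_range _ _))
      rwa [Set.image_univ] at hspan
    rw [← hrank, Matrix.rank_eq_finrank_span_row, h1, Set.image_eq_range, finrank_span_eq_card hb,
      ← Nat.card_eq_fintype_card, Nat.card_coe_set_eq]
  let B : Set (Sym2 V) := Subtype.val '' {e : G.graph.edgeSet | Sum.inl e ∈ b}
  have hB : (SimpleGraph.fromEdgeSet B).edgeSet = B := by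
    rw [SimpleGraph.edgeSet_fromEdgeSet, sdiff_eq_left, Set.disjoint_left]
    rintro _ ⟨e, -, rfl⟩ hdiag
    exact G.graph.not_isDiag_of_mem_edgeSet e.2 hdiag
  let H : G.SpanningSubgraph :=
    { graph := SimpleGraph.fromEdgeSet B
      graph_le := by
        rw [← SimpleGraph.edgeSet_subset_edgeSet, hB]
        rintro _ ⟨e, -, rfl⟩
        exact e.2
      loops := {l | Sum.inr l ∈ b} }
  let InX : Finset V → G.graph.edgeSet ⊕ L → Prop := fun X =>
    Sum.elim (fun e => ∀ x ∈ (e : Sym2 V), x ∈ X) fun l => G.base l ∈ X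
  have hcount : ∀ X : Finset V, H.toLooped.inducedCount X = {r | r ∈ b ∧ InX X r}.ncard := by
    intro X
    set A : Set G.graph.edgeSet := {e | Sum.inl e ∈ b ∧ ∀ x ∈ (e : Sym2 V), x ∈ X} with hA
    set D : Set H.loops := {l | G.base l ∈ X} with hD
    have h1 : {e : Sym2 V | e ∈ H.toLooped.graph.edgeSet ∧ ∀ x ∈ e, x ∈ X} = Subtype.val '' A := by
      ext e
      constructor
      · rintro ⟨he, hx⟩
        obtain ⟨e, heb, rfl⟩ : e ∈ B := hB ▸ he
        exact ⟨e, ⟨heb, hx⟩, rfl⟩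
      · rintro ⟨e, ⟨he, hx⟩, rfl⟩
        refine ⟨?_, hx⟩
        change (e : Sym2 V) ∈ (SimpleGraph.fromEdgeSet B).edgeSet
        rw [hB]
        exact ⟨e, he, rfl⟩
    have h2 : {r | r ∈ b ∧ InX X r} = Sum.inl '' A ∪ (fun l : H.loops => Sum.inr (l : L)) '' D := by
      ext r
      constructor
      · rcases r with e | l
        · rintro ⟨he, hx⟩
          exact Or.inl ⟨e, ⟨he, hx⟩, rfl⟩
        · rintro ⟨hl, hx⟩
          exact Or.inr ⟨⟨l, hl⟩, hx, rfl⟩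
      · rintro (⟨e, ⟨he, hx⟩, rfl⟩ | ⟨l, hx, rfl⟩)
        · exact ⟨he, hx⟩
        · exact ⟨l.2, hx⟩
    rw [inducedCount, h1, h2, Set.ncard_union_eq, Set.ncard_image_of_injective _ Sum.inl_injective,
      Set.ncard_image_of_injective _ Subtype.val_injective]
    · congr 1
      exact (Set.ncard_image_of_injective D
        (Sum.inr_injective.comp Subtype.val_injective)).symm
    · rw [Set.disjoint_left]
      rintro _ ⟨e, -, rfl⟩ ⟨l, -, h⟩
      cases h
  refine ⟨H, ⟨fun X => ?_, ?_⟩, ?_, fun x => ?_⟩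
  · rw [hcount]
    refine ncard_le_of_linearIndepOn (hb.mono (Set.sep_subset b (InX X))) X ?_
    rintro (e | l) ⟨-, hr⟩ ⟨w, k⟩ hw
    · exact edgeEntry_of_notMem p k fun hwe => hw (hr w hwe)
    · refine if_neg fun hwl : w = G.base l => hw ?_
      rw [hwl]
      exact hr
  · rw [← inducedCount_univ, hcount, Nat.card_eq_fintype_card, ← hbcard]
    congr 1
    ext r
    rcases r with e | l <;> simp [InX]
  · refine cliqueFree_of_rowsIndependent (p := p) ?_
    have hmem : ∀ e : (SimpleGraph.fromEdgeSet B).edgeSet,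
        ∃ e' : G.graph.edgeSet, Sum.inl e' ∈ b ∧ (e' : Sym2 V) = e := by
      rintro ⟨e, he⟩
      rw [hB] at he
      exact he
    choose φ hφb hφ using hmem
    have h1 := hb.linearIndependent.comp
      (fun e : (SimpleGraph.fromEdgeSet B).edgeSet => (⟨Sum.inl (φ e), hφb e⟩ : b)) (by
      intro e e' h
      have h' : φ e = φ e' := by simpa using h
      exact Subtype.ext (by rw [← hφ e, ← hφ e', h']))
    let ρ : (V × Fin d → ℝ) →ₗ[ℝ] (↥(Set.univ : Set V) × Fin d → ℝ) :=
      LinearMap.funLeft ℝ ℝ fun c => (c.1, c.2)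
    have hρ : LinearMap.ker ρ = ⊥ := LinearMap.ker_eq_bot.2
      (LinearMap.funLeft_injective_of_surjective ℝ ℝ _ fun c =>
        ⟨(⟨c.1, Set.mem_univ _⟩, c.2), rfl⟩)
    have h2 := h1.map' ρ hρ
    have h3 : (fun (e : (SimpleGraph.fromEdgeSet B).edgeSet) (c : ↥(Set.univ : Set V) × Fin d) =>
        edgeEntry p (c.1 : V) c.2 (e : Sym2 V)) =
        ρ ∘ (fun r : b => M.row r) ∘ fun e => ⟨Sum.inl (φ e), hφb e⟩ := by
      ext e ⟨w, k⟩
      change _ = edgeEntry p w k (φ e : Sym2 V)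
      rw [hφ]
    rw [← h3] at h2
    exact h2
  · have hgH : ∀ j, g j ∈ H.loops := fun j => hsb ⟨j, rfl⟩
    let γ : Fin s → H.loops := fun i => ⟨g (x, i), hgH _⟩
    have hγ : Function.Injective γ := by
      intro i i' h
      have h' := hg (congrArg Subtype.val h)
      exact (Prod.mk.inj h').2
    calc s = (Set.univ : Set (Fin s)).ncard := by simp [Set.ncard_univ]
      _ = (γ '' Set.univ).ncard := (Set.ncard_image_of_injective _ hγ).symm
      _ ≤ H.toLooped.loopCount x := by
        refine Set.ncard_le_ncard ?_
        rintro _ ⟨i, -, rfl⟩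
        exact hgb (x, i)

end LoopedSimpleGraph

theorem mainTheorem2 {V : Type*} {L : Type*} [Fintype V] [DecidableEq V] [Finite L]
    (d : ℕ) (hd : 2 ≤ d) (G : LoopedSimpleGraph V L) (hG : ∀ x : V, d / 2 ≤ G.loopCount x) :
    G.IsRigid d ↔
      ∃ H : G.SpanningSubgraph,
        H.toLooped.IsTight d ∧ H.toLooped.graph.CliqueFree (d + 2) ∧
          ∀ x : V, d / 2 ≤ H.toLooped.loopCount x := by
  constructor
  · intro h
    exact h.exists_isTight (Nat.div_le_self d 2) hG
  · rintro ⟨H, hH, hcf, hl⟩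
    exact H.isRigid (LoopedSimpleGraph.IsTight.isRigid hd H.toLooped hH hcf hl)
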